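/- Let $m,k,n$ be integers with $1\le m,k\le n-1$, and let $\alpha\in\mathbb C$. For $1\le m\le n$ let $V_{n,m}=\{v\in\mathbb R^{n\times m}: v'v=I_m\}$ be the Stiefel manifold ($v'$ is the transpose), with the $O(n)$-invariant Borel probability measure $d_*v$ (the image of the normalized invariant measure of $O(n)$ under $g\mapsto g v_0$, $v_0\in V_{n,m}$ fixed); functions in $L^1$ are complex-valued. For a square matrix $a$ let $|a|$ be the absolute value of $\det a$. For $f\in L^1(V_{n,m})$, $\varphi\in L^1(V_{n,k})$, $u\in V_{n,k}$, $v\in V_{n,m}$ define the cosine transform, the sine transform and their duals by $$(\mathcal C^{\alpha}_{m,k} f)(u)=\int_{V_{n,m}} f(v)\,|v'uu'v|^{(\alpha-k)/2}\,d_*v,\qquad (\overset{*}{\mathcal C}{}^{\alpha}_{m,k}\varphi)(v)=\int_{V_{n,k}}\varphi(u)\,|v'uu'v|^{(\alpha-k)/2}\,d_*u,$$ $$(\mathcal S^{\alpha}_{m,k} f)(u)=\int_{V_{n,m}} f(v)\,|I_m-v'uu'v|^{(\alpha+k-n)/2}\,d_*v,\qquad (\overset{*}{\mathcal S}{}^{\alpha}_{m,k}\varphi)(v)=\int_{V_{n,k}}\varphi(u)\,|I_m-v'uu'v|^{(\alpha+k-n)/2}\,d_*u.$$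 The cosine transforms are considered for $m\le k$ and the sine transforms for $m\le n-k$ (otherwise the determinants vanish identically). For $\operatorname{Re}\beta>(m-1)/2$ let $$\Gamma_m(\beta)=\int_{\Omega}e^{-\operatorname{tr} r}\,|r|^{\beta-(m+1)/2}\,dr,\qquad dr=\prod_{i\le j}dr_{i,j},$$ be the Siegel gamma function, where $\Omega$ is the cone of positive definite real symmetric $m\times m$ matrices. (i) Let $f\in L^1(V_{n,m})$ and $\varphi\in L^1(V_{n,k})$, neither of them equal to zero almost everywhere. If $m\le k$, then each of the integrals $(\mathcal C^{\alpha}_{m,k} f)(u)$ and $(\overset{*}{\mathcal C}{}^{\alpha}_{m,k}\varphi)(v)$ converges absolutely for almost all $u$, respectively $v$, if and only if $\operatorname{Re}\alpha>m-1$. If $m\le n-k$, then the same holds for each of the integrals $(\mathcal S^{\alpha}_{m,k} f)(u)$ and $(\overset{*}{\mathcal S}{}^{\alpha}_{m,k}\varphi)(v)$. (ii) Let $m\le k$ and $\operatorname{Re}\alpha>m-1$. For all $f\in L^1(V_{n,m})$ and $\varphi\in L^1(V_{n,k})$ the functions $\mathcal C^{\alpha}_{m,k} f$ and $\overset{*}{\mathcal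 C}{}^{\alpha}_{m,k}\varphi$ are integrable, and $$\int_{V_{n,k}}(\mathcal C^{\alpha}_{m,k}f)(u)\,d_*u=c_1\int_{V_{n,m}}f(v)\,d_*v,\qquad \int_{V_{n,m}}(\overset{*}{\mathcal C}{}^{\alpha}_{m,k}\varphi)(v)\,d_*v=c_1\int_{V_{n,k}}\varphi(u)\,d_*u,$$ $$c_1=\frac{\Gamma_m(n/2)\,\Gamma_m(\alpha/2)}{\Gamma_m(k/2)\,\Gamma_m((\alpha+n-k)/2)}.$$ (iii) Let $m\le n-k$ and $\operatorname{Re}\alpha>m-1$. For all $f\in L^1(V_{n,m})$ and $\varphi\in L^1(V_{n,k})$ the functions $\mathcal S^{\alpha}_{m,k} f$ and $\overset{*}{\mathcal S}{}^{\alpha}_{m,k}\varphi$ are integrable, and $$\int_{V_{n,k}}(\mathcal S^{\alpha}_{m,k}f)(u)\,d_*u=c_2\int_{V_{n,m}}f(v)\,d_*v,\qquad \int_{V_{n,m}}(\overset{*}{\mathcal S}{}^{\alpha}_{m,k}\varphi)(v)\,d_*v=c_2\int_{V_{n,k}}\varphi(u)\,d_*u,$$ $$c_2=\frac{\Gamma_m(n/2)\,\Gamma_m(\alpha/2)}{\Gamma_m((n-k)/2)\,\Gamma_m((\alpha+k)/2)}.$$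 -/

import Mathlib

open MeasureTheory Matrix

noncomputable section

namespace StiefelTransform

/-- The Stiefel manifold `V_{n,m}` of orthonormal `m`-frames in `ℝⁿ`. -/
def Stiefel (n m : ℕ) : Type :=
  {v : Matrix (Fin n) (Fin m) ℝ // vᵀ * v = 1}

/-- The underlying `n × m` matrix of a frame. -/
def Stiefel.mat {n m : ℕ} (v : Stiefel n m) : Matrix (Fin n) (Fin m) ℝ :=
  Subtype.val v

/-- `V_{n,m}` carries the subspace topology of the space of matrices. -/
instance (n m : ℕ) : TopologicalSpace (Stiefel n m) :=
  TopologicalSpace.induced Stiefel.mat inferInstance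

/-- `V_{n,m}` carries its Borel σ-algebra. -/
instance (n m : ℕ) : MeasurableSpace (Stiefel n m) := borel _

instance (n m : ℕ) : BorelSpace (Stiefel n m) := ⟨rfl⟩

/-- The orthogonal group `O(n)` carries its Borel σ-algebra. -/
instance (n : ℕ) : MeasurableSpace (orthogonalGroup (Fin n) ℝ) := borel _

instance (n : ℕ) : BorelSpace (orthogonalGroup (Fin n) ℝ) := ⟨rfl⟩

instance (n : ℕ) : CompactSpace (orthogonalGroup (Fin n) ℝ) := by
  have hc : IsCompact (Set.pi Set.univ fun _ : Fin n => Set.pi Set.univ fun _ : Fin n =>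
      Metric.closedBall (0 : ℝ) 1) :=
    isCompact_univ_pi fun _ => isCompact_univ_pi fun _ => isCompact_closedBall _ _
  have hcl : IsClosed ((orthogonalGroup (Fin n) ℝ : Submonoid (Matrix (Fin n) (Fin n) ℝ)) :
      Set (Matrix (Fin n) (Fin n) ℝ)) :=
    isClosed_unitary
  refine isCompact_iff_compactSpace.mp (IsCompact.of_isClosed_subset hc hcl ?_)
  intro U hU i _ j _
  rw [mem_closedBall_zero_iff]
  exact entry_norm_bound_of_unitary (𝕜 := ℝ) hU i j

/-- The invariant measure of total mass one on `O(n)`. -/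
def orthogonalHaar (n : ℕ) : Measure (orthogonalGroup (Fin n) ℝ) :=
  Measure.haarMeasure ⊤

/-- The frame in `V_{n,m}` consisting of the first `m` standard basis vectors. -/
def baseFrame {n m : ℕ} (h : m ≤ n) : Stiefel n m :=
  ⟨(1 : Matrix (Fin n) (Fin n) ℝ).submatrix id (Fin.castLE h), by
    ext i j
    simp [Matrix.mul_apply, Matrix.one_apply, Fin.castLE_inj, eq_comm]⟩

/-- The action of `O(n)` on `V_{n,m}` by left multiplication. -/
def rotate {n m : ℕ} (g : orthogonalGroup (Fin n) ℝ) (v : Stiefel n m) : Stiefel n m :=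
  ⟨(g : Matrix (Fin n) (Fin n) ℝ) * v.mat, by
    have hg : (g : Matrix (Fin n) (Fin n) ℝ)ᵀ * (g : Matrix (Fin n) (Fin n) ℝ) = 1 :=
      (mem_orthogonalGroup_iff' (Fin n) ℝ).mp g.2
    have hv : v.matᵀ * v.mat = 1 := v.2
    rw [Matrix.transpose_mul, Matrix.mul_assoc, ← Matrix.mul_assoc _ _ v.mat, hg,
      Matrix.one_mul, hv]⟩

/-- The invariant probability measure `d_*v` on `V_{n,m} = O(n)/O(n-m)`: the image of the
normalized invariant measure of `O(n)` under the orbit map of a frame. -/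
def stiefelMeasure {n m : ℕ} (h : m ≤ n) : Measure (Stiefel n m) :=
  (orthogonalHaar n).map fun g => rotate g (baseFrame h)

theorem measurable_rotate {n m : ℕ} (v : Stiefel n m) :
    Measurable fun g : orthogonalGroup (Fin n) ℝ => rotate g v := by
  refine Continuous.measurable (continuous_induced_rng.mpr ?_)
  change Continuous fun g : orthogonalGroup (Fin n) ℝ => (g : Matrix (Fin n) (Fin n) ℝ) * v.mat
  fun_prop

instance {n m : ℕ} (h : m ≤ n) : IsProbabilityMeasure (stiefelMeasure h) := by
  constructor
  rw [stiefelMeasure, Measure.map_apply (measurable_rotate _) MeasurableSet.univ,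
    Set.preimage_univ]
  exact Measure.haarMeasure_self

/-- The real symmetric matrix with prescribed entries on and above the diagonal. -/
def symMatrix {m : ℕ} (s : {p : Fin m × Fin m // p.1 ≤ p.2} → ℝ) :
    Matrix (Fin m) (Fin m) ℝ :=
  fun i j => s ⟨(min i j, max i j), min_le_max⟩

/-- The Siegel gamma function
`Γ_m(α) = ∫_Ω exp(-tr r) |r|^(α - (m+1)/2) dr`, `dr = ∏_{i ≤ j} dr_{i,j}`, where `Ω` is the cone
of positive definite real symmetric `m × m` matrices. The integral converges for
`Re α > (m-1)/2`. -/
def siegelGamma (m : ℕ) (α : ℂ) : ℂ :=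
  ∫ s in {s : {p : Fin m × Fin m // p.1 ≤ p.2} → ℝ | (symMatrix s).PosDef},
    (Real.exp (-(symMatrix s).trace) : ℂ) *
      (((symMatrix s).det : ℝ) : ℂ) ^ (α - ((m : ℂ) + 1) / 2)

/-- The cosine kernel `|v'uu'v|^((α-k)/2)`, where `|a|` is the absolute value of `det a`. -/
def cosKernel {n m k : ℕ} (α : ℂ) (v : Stiefel n m) (u : Stiefel n k) : ℂ :=
  ((|(v.matᵀ * u.mat * u.matᵀ * v.mat).det| : ℝ) : ℂ) ^ ((α - k) / 2)

/-- The sine kernel `|I_m - v'uu'v|^((α+k-n)/2)`. -/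
def sinKernel {n m k : ℕ} (α : ℂ) (v : Stiefel n m) (u : Stiefel n k) : ℂ :=
  ((|(1 - v.matᵀ * u.mat * u.matᵀ * v.mat).det| : ℝ) : ℂ) ^ ((α + k - n) / 2)

/-- The cosine transform `C^α_{m,k} f`. -/
def cosTransform {n m : ℕ} (hm : m ≤ n) (k : ℕ) (α : ℂ) (f : Stiefel n m → ℂ)
    (u : Stiefel n k) : ℂ :=
  ∫ v, f v * cosKernel α v u ∂stiefelMeasure hm

/-- The dual cosine transform of `φ`. -/
def dualCosTransform {n k : ℕ} (hk : k ≤ n) (m : ℕ) (α : ℂ) (φ : Stiefel n k → ℂ)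
    (v : Stiefel n m) : ℂ :=
  ∫ u, φ u * cosKernel α v u ∂stiefelMeasure hk

/-- The sine transform `S^α_{m,k} f`. -/
def sinTransform {n m : ℕ} (hm : m ≤ n) (k : ℕ) (α : ℂ) (f : Stiefel n m → ℂ)
    (u : Stiefel n k) : ℂ :=
  ∫ v, f v * sinKernel α v u ∂stiefelMeasure hm

/-- The dual sine transform of `φ`. -/
def dualSinTransform {n k : ℕ} (hk : k ≤ n) (m : ℕ) (α : ℂ) (φ : Stiefel n k → ℂ)
    (v : Stiefel n m) : ℂ :=
  ∫ u, φ u * sinKernel α v u ∂stiefelMeasure hk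

/-- The constant of the cosine transforms. -/
def cosConst (n m k : ℕ) (α : ℂ) : ℂ :=
  siegelGamma m ((n : ℂ) / 2) * siegelGamma m (α / 2) /
    (siegelGamma m ((k : ℂ) / 2) * siegelGamma m ((α + n - k) / 2))

/-- The constant of the sine transforms. -/
def sinConst (n m k : ℕ) (α : ℂ) : ℂ :=
  siegelGamma m ((n : ℂ) / 2) * siegelGamma m (α / 2) /
    (siegelGamma m (((n : ℂ) - k) / 2) * siegelGamma m ((α + k) / 2))

end StiefelTransform

end

open StiefelTransform

/-! Pulled back to `O(n)`, each kernel becomes a function `q(g⁻¹h)`. If `q` is integrable, Fubini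
and invariance of the Haar measure give integrability of the transforms and the mean value identity
with constant `∫ q` (`integrable_mul_invariantKernel`). If `∫ |q| = ∞`, a Tonelli argument shows
that no nonzero `f` has an a.e. absolutely convergent transform
(`not_ae_integrable_mul_invariantKernel`). Duals follow by inversion `g ↦ g⁻¹`, and the sine kernel
for `k` is the cosine kernel for `n - k` after a right translation (`one_sub_blockGram`).

What remains are the moments of `det(BB')`, where `B` is the upper left `m × k` block of a Haar
distributed orthogonal matrix. For a Gaussian `m × n` matrix `X`, averaging over rotations shows
that the Gram determinant of its first `k` columns is distributed as `det(BB')` times an independent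
copy of `det(XX')` (`lintegral_splitCoords_eq_lintegral_orthogonalHaar`). Both Gram determinants
follow explicit laws on the positive cone (`exists_lintegral_det_dotGram`), so the moment of order
`s` is a constant times `Γ_m(k/2+s) / Γ_m(n/2+s)`, and `s = 0` fixes the constant.

Only laws of determinants are needed, not of whole matrices. The law of `det r` under `exp(-tr r)
dr` is a multiplicative convolution of one-dimensional gamma densities, by Schur complements and
induction on `m` (`siegelDetMeasure_succ`). Its moments are finite above the exponent `-1`, where `∫
exp(-a) a⁻¹ da` diverges; this is the threshold `Re α = m - 1`. -/

noncomputable section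

namespace StiefelTransform

open scoped ENNReal

/-! ### Invariant kernels on pairs of homogeneous spaces. -/

section Homogeneous

variable {G X Y : Type*} [Group G] [MeasurableSpace G] [MeasurableMul₂ G] [MeasurableInv G]
  [MeasurableSpace X] [MeasurableSpace Y] {μ : Measure G} [IsProbabilityMeasure μ]
  {a : G → X} {b : G → Y} {K : X → Y → ℂ} {q : G → ℂ}

/-- Against an invariant kernel, an integrable function gives a function integrable on the product
of the two homogeneous spaces. -/
theorem integrable_mul_invariantKernel [μ.IsMulLeftInvariant] (ha : Measurable a)
    (hb : Measurable b) (hK : Measurable (Function.uncurry K))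
    (hq : ∀ g h, K (a g) (b h) = q (g⁻¹ * h)) (hqi : Integrable q μ) {f : X → ℂ}
    (hf : Integrable f (μ.map a)) :
    Integrable (fun p : X × Y => f p.1 * K p.1 p.2) ((μ.map a).prod (μ.map b)) ∧
      ∫ p : X × Y, f p.1 * K p.1 p.2 ∂((μ.map a).prod (μ.map b)) =
        (∫ g, q g ∂μ) * ∫ x, f x ∂(μ.map a) := by
  have := Measure.isProbabilityMeasure_map (μ := μ) ha.aemeasurable
  have := Measure.isProbabilityMeasure_map (μ := μ) hb.aemeasurable
  have hmeas : AEStronglyMeasurable (fun p : X × Y => f p.1 * K p.1 p.2)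
      ((μ.map a).prod (μ.map b)) :=
    hf.aestronglyMeasurable.comp_fst.mul hK.aestronglyMeasurable
  -- The shear `(g, h) ↦ (g, g⁻¹h)` preserves the product measure and separates the variables of
  -- `f(a g) q(g⁻¹h)`.
  have hshear := measurePreserving_prod_inv_mul μ μ
  have hfa : Integrable (fun g => f (a g)) μ := hf.comp_measurable ha
  have hprod : Integrable (fun p : G × G => f (a p.1) * q p.2) (μ.prod μ) := hfa.mul_prod hqi
  have heq : (fun p : G × G => f (a p.1) * K (a p.1) (b p.2)) =
      (fun p : G × G => f (a p.1) * q p.2) ∘ fun z : G × G => (z.1, z.1⁻¹ * z.2) := by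
    ext p
    simp [hq]
  rw [Measure.map_prod_map _ _ ha hb] at hmeas ⊢
  constructor
  · rw [integrable_map_measure hmeas (ha.prodMap hb).aemeasurable]
    change Integrable (fun p : G × G => f (a p.1) * K (a p.1) (b p.2)) _
    rw [heq]
    exact hshear.integrable_comp_of_integrable hprod
  · rw [integral_map (ha.prodMap hb).aemeasurable hmeas]
    change ∫ p : G × G, f (a p.1) * K (a p.1) (b p.2) ∂_ = _
    rw [heq, integral_map ha.aemeasurable hf.aestronglyMeasurable]
    have h1 : ∫ p, ((fun p : G × G => f (a p.1) * q p.2) ∘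
        fun z : G × G => (z.1, z.1⁻¹ * z.2)) p ∂(μ.prod μ) =
        ∫ p, f (a p.1) * q p.2 ∂(μ.prod μ) := by
      conv_rhs => rw [← hshear.map_eq]
      rw [integral_map hshear.measurable.aemeasurable]
      · rfl
      · rw [hshear.map_eq]
        exact hprod.aestronglyMeasurable
    rw [h1, integral_prod_mul (fun g => f (a g)) q, mul_comm]

/-- If an invariant kernel is not integrable, the corresponding transform of a nonzero integrable
function diverges on a set of positive measure. -/
theorem not_ae_integrable_mul_invariantKernel [μ.IsMulLeftInvariant] [μ.IsMulRightInvariant]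
    (ha : Measurable a) (hb : Measurable b) (hK : Measurable (Function.uncurry K))
    (hqm : Measurable q) (hq : ∀ g h, K (a g) (b h) = q (g⁻¹ * h))
    (hqi : ∫⁻ g, ‖q g‖ₑ ∂μ = ∞) {f : X → ℂ} (hf : Integrable f (μ.map a))
    (hf0 : ¬ f =ᵐ[μ.map a] 0) :
    ¬ ∀ᵐ y ∂(μ.map b), Integrable (fun x => f x * K x y) (μ.map a) := by
  intro hint
  have := Measure.isProbabilityMeasure_map (μ := μ) ha.aemeasurable
  have := Measure.isProbabilityMeasure_map (μ := μ) hb.aemeasurable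
  wlog hfm : StronglyMeasurable f generalizing f
  · have hae := hf.aestronglyMeasurable.ae_eq_mk
    refine this (f := hf.aestronglyMeasurable.mk f) (hf.congr hae) (fun h => hf0 (hae.trans h)) ?_
      hf.aestronglyMeasurable.stronglyMeasurable_mk
    filter_upwards [hint] with y hy
    refine hy.congr ?_
    filter_upwards [hae] with x hx
    rw [hx]
  have hfm' := hfm.measurable
  have hjoint : Measurable fun p : X × Y => ‖f p.1‖ₑ * ‖K p.1 p.2‖ₑ :=
    (hfm'.comp measurable_fst).enorm.mul hK.enorm
  set T : Y → ℝ≥0∞ := fun y => ∫⁻ x, ‖f x‖ₑ * ‖K x y‖ₑ ∂(μ.map a) with hT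
  have hTm : Measurable T := hjoint.lintegral_prod_left'
  have hTfin : ∀ᵐ y ∂(μ.map b), T y < ∞ := by
    filter_upwards [hint] with y hy
    have := hy.2
    rw [HasFiniteIntegral] at this
    simpa [hT, enorm_mul] using this
  set c : ℝ≥0∞ := ∫⁻ g, ‖f (a g)‖ₑ ∂μ with hc
  have hcfin : c ≠ ∞ := (hf.comp_measurable ha).2.ne
  have hc0 : c ≠ 0 := by
    intro h0
    apply hf0
    have h1 : ∫⁻ x, ‖f x‖ₑ ∂(μ.map a) = 0 := by
      rw [lintegral_map hfm'.enorm ha]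
      exact h0
    rw [lintegral_eq_zero_iff hfm'.enorm] at h1
    filter_upwards [h1] with x hx
    simpa using hx
  -- Absolute continuity of the integral: a set of measure below `δ` carries less than half of the
  -- mass `c` of `f`. Some level set `{T > j}` is that small, because `T` is finite almost
  -- everywhere.
  obtain ⟨δ, hδ, hsmall⟩ := exists_pos_setLIntegral_lt_of_measure_lt (μ := μ)
    (f := fun g => ‖f (a g)‖ₑ) hcfin (ENNReal.half_pos hc0).ne'
  set s : ℕ → Set Y := fun j => {y | (j : ℝ≥0∞) < T y} with hs
  have hsm : ∀ j, MeasurableSet (s j) := fun j => measurableSet_lt measurable_const hTm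
  have hlim : Filter.Tendsto (fun j => μ.map b (s j)) Filter.atTop (nhds 0) := by
    have hzero : μ.map b (⋂ j, s j) = 0 := by
      refine measure_mono_null ?_ (ae_iff.mp hTfin)
      intro y hy
      simp only [hs, Set.mem_iInter, Set.mem_ofPred_eq] at hy ⊢
      intro hlt
      obtain ⟨j, hj⟩ := ENNReal.exists_nat_gt hlt.ne
      exact absurd (hy j) (not_lt.mpr hj.le)
    rw [← hzero]
    refine tendsto_measure_iInter_atTop (fun j => (hsm j).nullMeasurableSet) ?_
      ⟨0, measure_ne_top _ _⟩
    intro i j hij y hy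
    simp only [hs, Set.mem_ofPred_eq] at hy ⊢
    exact lt_of_le_of_lt (Nat.cast_le.mpr hij) hy
  obtain ⟨j, hj⟩ := ((tendsto_order.1 hlim).2 δ hδ).exists
  have hupper : ∫⁻ y in (s j)ᶜ, T y ∂(μ.map b) ≤ j := by
    calc ∫⁻ y in (s j)ᶜ, T y ∂(μ.map b) ≤ ∫⁻ y in (s j)ᶜ, (j : ℝ≥0∞) ∂(μ.map b) :=
          setLIntegral_mono' (hsm j).compl fun y hy => not_lt.mp hy
      _ ≤ j := by
          rw [setLIntegral_const]
          exact mul_le_of_le_one_right' prob_le_one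
  -- Right invariance makes the translates of the small level set equally small, so at least half of
  -- the mass of `f` survives its removal, uniformly in `h`.
  have hlower : ∀ h, c / 2 ≤ ∫⁻ g, ‖f (a g)‖ₑ * (s j)ᶜ.indicator 1 (b (g * h)) ∂μ := by
    intro h
    set t : Set G := (fun g => g * h) ⁻¹' (b ⁻¹' s j) with ht
    have htm : MeasurableSet t := (hb.comp (measurable_mul_const h)) (hsm j)
    have hμt : μ t = μ.map b (s j) := by
      rw [Measure.map_apply hb (hsm j), ht, measure_preimage_mul_right μ h]
    have hlt := hsmall t (hμt ▸ hj)
    have hsplit := lintegral_add_compl (μ := μ) (fun g => ‖f (a g)‖ₑ) htm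
    have hrew : ∫⁻ g, ‖f (a g)‖ₑ * (s j)ᶜ.indicator 1 (b (g * h)) ∂μ =
        ∫⁻ g in tᶜ, ‖f (a g)‖ₑ ∂μ := by
      rw [← lintegral_indicator htm.compl]
      congr 1
      ext g
      by_cases hg : b (g * h) ∈ s j <;> simp [Set.indicator, ht, hg]
    rw [hrew]
    by_contra! hcon
    have : c < c / 2 + c / 2 := by
      calc c = _ := hsplit.symm
        _ < _ := ENNReal.add_lt_add hlt hcon
    rw [ENNReal.add_halves] at this
    exact lt_irrefl _ this
  have hind : Measurable ((s j)ᶜ.indicator (1 : Y → ℝ≥0∞)) :=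
    measurable_one.indicator (hsm j).compl
  -- Tonelli and the substitution `h ↦ gh` bring out the factor `|q(h)|`. With `hlower` the integral
  -- is at least `(c/2) ∫ |q| = ∞`, against the bound `j` from `hupper`.
  have hkey : ∫⁻ y in (s j)ᶜ, T y ∂(μ.map b) =
      ∫⁻ h, ‖q h‖ₑ * ∫⁻ g, ‖f (a g)‖ₑ * (s j)ᶜ.indicator 1 (b (g * h)) ∂μ ∂μ := by
    have hfa : Measurable fun g => ‖f (a g)‖ₑ := (hfm'.comp ha).enorm
    calc ∫⁻ y in (s j)ᶜ, T y ∂(μ.map b)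
        = ∫⁻ y, (s j)ᶜ.indicator 1 y * T y ∂(μ.map b) := by
          rw [← lintegral_indicator (hsm j).compl]
          congr 1
          ext y
          by_cases hy : y ∈ s j <;> simp [Set.indicator, hy]
      _ = ∫⁻ h, (s j)ᶜ.indicator 1 (b h) * ∫⁻ g, ‖f (a g)‖ₑ * ‖q (g⁻¹ * h)‖ₑ ∂μ ∂μ := by
          rw [lintegral_map (f := fun y => (s j)ᶜ.indicator 1 y * T y) (hind.mul hTm) hb]
          congr 1
          ext h
          simp only [hT]
          rw [lintegral_map (f := fun x => ‖f x‖ₑ * ‖K x (b h)‖ₑ)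
            (hjoint.comp measurable_prodMk_right) ha]
          simp [hq]
      _ = ∫⁻ h, ∫⁻ g, (s j)ᶜ.indicator 1 (b h) * (‖f (a g)‖ₑ * ‖q (g⁻¹ * h)‖ₑ) ∂μ ∂μ := by
          congr 1
          ext h
          rw [lintegral_const_mul]
          fun_prop
      _ = ∫⁻ g, ∫⁻ h, (s j)ᶜ.indicator 1 (b h) * (‖f (a g)‖ₑ * ‖q (g⁻¹ * h)‖ₑ) ∂μ ∂μ := by
          rw [lintegral_lintegral_swap]
          apply Measurable.aemeasurable
          exact (hind.comp (hb.comp measurable_fst)).mul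
            ((hfa.comp measurable_snd).mul (by fun_prop))
      _ = ∫⁻ g, ∫⁻ h, (s j)ᶜ.indicator 1 (b (g * h)) * (‖f (a g)‖ₑ * ‖q h‖ₑ) ∂μ ∂μ := by
          congr 1
          ext g
          rw [← lintegral_mul_left_eq_self _ g]
          simp
      _ = ∫⁻ h, ∫⁻ g, (s j)ᶜ.indicator 1 (b (g * h)) * (‖f (a g)‖ₑ * ‖q h‖ₑ) ∂μ ∂μ := by
          rw [lintegral_lintegral_swap]
          apply Measurable.aemeasurable
          exact (hind.comp (hb.comp (measurable_fst.mul measurable_snd))).mul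
            ((hfa.comp measurable_fst).mul (by fun_prop))
      _ = _ := by
          congr 1
          ext h
          rw [← lintegral_const_mul]
          · congr 1
            ext g
            ring
          · exact hfa.mul (hind.comp (hb.comp (measurable_mul_const h)))
  have htop : ∫⁻ y in (s j)ᶜ, T y ∂(μ.map b) = ∞ := by
    rw [hkey, eq_top_iff]
    calc ∞ = (∫⁻ h, ‖q h‖ₑ ∂μ) * (c / 2) := by
          rw [hqi, ENNReal.top_mul (ENNReal.half_pos hc0).ne']
      _ = ∫⁻ h, ‖q h‖ₑ * (c / 2) ∂μ := (lintegral_mul_const _ hqm.enorm).symm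
      _ ≤ _ := lintegral_mono fun h => mul_le_mul_right (hlower h) _
  rw [htop] at hupper
  exact absurd hupper (by simp)

end Homogeneous

/-! ### Schur complements of bordered symmetric matrices. -/

section Bordered

variable {m : ℕ}

/-- The symmetric block matrix with corner `a`, border `b` and block `D`. -/
def bordered (a : ℝ) (b : Fin m → ℝ) (D : Matrix (Fin m) (Fin m) ℝ) :
    Matrix (Fin (m + 1)) (Fin (m + 1)) ℝ :=
  Matrix.of (Fin.cons (Fin.cons a b) fun i => Fin.cons (b i) (D i))

@[simp] theorem bordered_zero_zero (a : ℝ) (b : Fin m → ℝ) (D : Matrix (Fin m) (Fin m) ℝ) :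
    bordered a b D 0 0 = a := rfl

@[simp] theorem bordered_zero_succ (a : ℝ) (b : Fin m → ℝ) (D : Matrix (Fin m) (Fin m) ℝ)
    (j : Fin m) : bordered a b D 0 j.succ = b j := rfl

@[simp] theorem bordered_succ_zero (a : ℝ) (b : Fin m → ℝ) (D : Matrix (Fin m) (Fin m) ℝ)
    (i : Fin m) : bordered a b D i.succ 0 = b i := rfl

@[simp] theorem bordered_succ_succ (a : ℝ) (b : Fin m → ℝ) (D : Matrix (Fin m) (Fin m) ℝ)
    (i j : Fin m) : bordered a b D i.succ j.succ = D i j := rfl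

theorem trace_bordered (a : ℝ) (b : Fin m → ℝ) (D : Matrix (Fin m) (Fin m) ℝ) :
    (bordered a b D).trace = a + D.trace := by
  simp [Matrix.trace, Fin.sum_univ_succ]

/-- The determinant through the Schur complement of the corner. -/
theorem det_bordered {a : ℝ} (ha : a ≠ 0) (b : Fin m → ℝ) (D : Matrix (Fin m) (Fin m) ℝ) :
    (bordered a b (D + a⁻¹ • vecMulVec b b)).det = a * D.det := by
  rw [Matrix.det_eq_of_forall_row_eq_smul_add_const (A := bordered a b (D + a⁻¹ • vecMulVec b b))
    (B := Matrix.of (Fin.cons (Fin.cons a b) fun i => Fin.cons 0 (D i)))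
    (fun i => (Fin.cons 0 (fun i => a⁻¹ * b i) : Fin (m + 1) → ℝ) i) 0 rfl]
  · rw [Matrix.det_succ_column_zero, Fin.sum_univ_succ]
    simp
    left
    rfl
  · intro i j
    refine Fin.cases ?_ (fun i => ?_) i <;> refine Fin.cases ?_ (fun j => ?_) j
    · simp
    · simp
    · simp; field_simp
    · simp [vecMulVec_apply]; ring

/-- Completing the square in the first coordinate; the correction term is absorbed by the rank one
summand. -/
theorem dotProduct_bordered_mulVec {a : ℝ} (ha : a ≠ 0) (b : Fin m → ℝ)
    (D : Matrix (Fin m) (Fin m) ℝ) (x : Fin (m + 1) → ℝ) :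
    x ⬝ᵥ bordered a b (D + a⁻¹ • vecMulVec b b) *ᵥ x =
      a * (x 0 + a⁻¹ * (b ⬝ᵥ Fin.tail x)) ^ 2 + Fin.tail x ⬝ᵥ D *ᵥ Fin.tail x := by
  have h : x ⬝ᵥ bordered a b (D + a⁻¹ • vecMulVec b b) *ᵥ x =
      a * x 0 ^ 2 + 2 * x 0 * (b ⬝ᵥ Fin.tail x) +
        Fin.tail x ⬝ᵥ (D + a⁻¹ • vecMulVec b b) *ᵥ Fin.tail x := by
    simp only [dotProduct, mulVec, Fin.sum_univ_succ, Fin.tail, bordered_zero_zero,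
      bordered_zero_succ, bordered_succ_zero, bordered_succ_succ]
    simp only [mul_add, Finset.sum_add_distrib]
    have : ∑ i, x i.succ * (b i * x 0) = x 0 * ∑ i, b i * x i.succ := by
      rw [Finset.mul_sum]
      exact Finset.sum_congr rfl fun i _ => by ring
    rw [this]
    ring
  rw [h, add_mulVec, dotProduct_add, smul_mulVec, dotProduct_smul, vecMulVec_mulVec]
  simp only [op_smul_eq_smul, dotProduct_smul, smul_eq_mul]
  rw [dotProduct_comm (Fin.tail x) b]
  field_simp
  ring

theorem posDef_bordered_iff {a : ℝ} (ha : 0 < a) (b : Fin m → ℝ) (D : Matrix (Fin m) (Fin m) ℝ) :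
    (bordered a b (D + a⁻¹ • vecMulVec b b)).PosDef ↔ D.PosDef := by
  have hsym : (bordered a b (D + a⁻¹ • vecMulVec b b)).IsHermitian ↔ D.IsHermitian := by
    constructor
    · intro h
      ext i j
      have := congr_fun (congr_fun h i.succ) j.succ
      simp [vecMulVec_apply] at this
      simp only [conjTranspose_apply, star_trivial]
      linarith [mul_comm (b i) (b j)]
    · intro h
      ext i j
      refine Fin.cases ?_ (fun i => ?_) i <;> refine Fin.cases ?_ (fun j => ?_) j
      · simp
      · simp
      · simp
      · have := congr_fun (congr_fun h i) j
        simp at this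
        simp [vecMulVec_apply, this]
        left; ring
  rw [posDef_iff_dotProduct_mulVec, posDef_iff_dotProduct_mulVec, hsym]
  refine and_congr_right fun _ => ?_
  simp only [star_trivial, dotProduct_bordered_mulVec ha.ne']
  constructor
  · intro h y hy
    -- The first coordinate is chosen to annihilate the completed square.
    have h1 := h (x := Fin.cons (-(a⁻¹ * (b ⬝ᵥ y))) y) (fun h0 => hy (by
      ext i
      simpa using congr_fun h0 i.succ))
    simpa [Fin.tail_cons] using h1
  · intro h x hx
    by_cases hy : Fin.tail x = 0
    · have hx0 : x 0 ≠ 0 := by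
        intro h0
        apply hx
        ext i
        refine Fin.cases h0 (fun i => ?_) i
        exact congr_fun hy i
      simp only [hy, dotProduct_zero, mul_zero, add_zero, zero_dotProduct]
      positivity
    · have := h hy
      positivity

end Bordered

/-! ### The law of the determinant on the cone of positive definite matrices. -/

/-- Splitting the entries on and above the diagonal into the corner, the rest of the first row,
and the remaining entries. -/
def upperIndexEquiv (m : ℕ) :
    Unit ⊕ (Fin m ⊕ {p : Fin m × Fin m // p.1 ≤ p.2}) ≃
      {p : Fin (m + 1) × Fin (m + 1) // p.1 ≤ p.2} :=
  Equiv.ofBijective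
    (Sum.elim (fun _ => ⟨(0, 0), le_rfl⟩) (Sum.elim (fun j => ⟨(0, j.succ), Fin.zero_le _⟩)
      fun p => ⟨(p.1.1.succ, p.1.2.succ), Fin.succ_le_succ_iff.mpr p.2⟩)) (by
    constructor
    · rintro (_ | _ | ⟨⟨p, q⟩, _⟩) (_ | _ | ⟨⟨p', q'⟩, _⟩) h <;>
        simp_all [Fin.ext_iff]
    · rintro ⟨⟨i, j⟩, h⟩
      revert h
      refine Fin.cases ?_ (fun i => ?_) i <;> refine Fin.cases ?_ (fun j => ?_) j <;> intro h
      · exact ⟨Sum.inl (), rfl⟩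
      · exact ⟨Sum.inr (Sum.inl j), rfl⟩
      · exact absurd h (by simp)
      · exact ⟨Sum.inr (Sum.inr ⟨(i, j), Fin.succ_le_succ_iff.mp h⟩), rfl⟩)

/-- The volume preserving assembly of a symmetric matrix from corner, border and block. -/
def assemble (m : ℕ) : ℝ × (Fin m → ℝ) × ({p : Fin m × Fin m // p.1 ≤ p.2} → ℝ) ≃ᵐ
    ({p : Fin (m + 1) × Fin (m + 1) // p.1 ≤ p.2} → ℝ) :=
  ((((MeasurableEquiv.funUnique Unit ℝ).symm.prodCongr
    (MeasurableEquiv.sumPiEquivProdPi fun _ : Fin m ⊕ {p : Fin m × Fin m // p.1 ≤ p.2} => ℝ).symm)).trans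
    (MeasurableEquiv.sumPiEquivProdPi
      fun _ : Unit ⊕ (Fin m ⊕ {p : Fin m × Fin m // p.1 ≤ p.2}) => ℝ).symm).trans
    (MeasurableEquiv.piCongrLeft (fun _ => ℝ) (upperIndexEquiv m))

theorem measurePreserving_assemble (m : ℕ) : MeasurePreserving (assemble m) := by
  refine (MeasurePreserving.trans (MeasurePreserving.trans (MeasurePreserving.prod
    (volume_preserving_funUnique Unit ℝ).symm
    (volume_measurePreserving_sumPiEquivProdPi_symm _))
    (volume_measurePreserving_sumPiEquivProdPi_symm _))
    (volume_measurePreserving_piCongrLeft _ _))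

theorem symMatrix_assemble {m : ℕ} (a : ℝ) (b : Fin m → ℝ)
    (s : {p : Fin m × Fin m // p.1 ≤ p.2} → ℝ) :
    symMatrix (assemble m (a, b, s)) = bordered a b (symMatrix s) := by
  have h0 : assemble m (a, b, s) (upperIndexEquiv m (Sum.inl ())) = a := by
    simp only [assemble, MeasurableEquiv.trans_apply, MeasurableEquiv.coe_piCongrLeft]
    rw [Equiv.piCongrLeft_apply_apply]
    rfl
  have h1 : ∀ j, assemble m (a, b, s) (upperIndexEquiv m (Sum.inr (Sum.inl j))) = b j := by
    intro j
    simp only [assemble, MeasurableEquiv.trans_apply, MeasurableEquiv.coe_piCongrLeft]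
    rw [Equiv.piCongrLeft_apply_apply]
    rfl
  have h2 : ∀ p, assemble m (a, b, s) (upperIndexEquiv m (Sum.inr (Sum.inr p))) = s p := by
    intro p
    simp only [assemble, MeasurableEquiv.trans_apply, MeasurableEquiv.coe_piCongrLeft]
    rw [Equiv.piCongrLeft_apply_apply]
    rfl
  ext i j
  refine Fin.cases ?_ (fun i => ?_) i <;> refine Fin.cases ?_ (fun j => ?_) j
  · exact h0
  · exact h1 j
  · exact h1 i
  · rw [bordered_succ_succ]
    rcases le_total i j with h | h
    · rw [symMatrix, symMatrix]
      convert h2 ⟨(min i j, max i j), min_le_max⟩ using 2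
      ext <;> simp [h] <;> rfl
    · rw [symMatrix, symMatrix]
      convert h2 ⟨(min i j, max i j), min_le_max⟩ using 2
      ext <;> simp [h] <;> rfl

theorem lintegral_exp_neg_mul_sq_norm {V : Type*} [NormedAddCommGroup V] [InnerProductSpace ℝ V]
    [FiniteDimensional ℝ V] [MeasurableSpace V] [BorelSpace V] {c : ℝ} (hc : 0 < c) :
    ∫⁻ v : V, ENNReal.ofReal (Real.exp (-c * ‖v‖ ^ 2)) =
      ENNReal.ofReal ((Real.pi / c) ^ (Module.finrank ℝ V / 2 : ℝ)) := by
  have h := GaussianFourier.integral_rexp_neg_mul_sq_norm (V := V) hc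
  rw [← h, ofReal_integral_eq_lintegral_ofReal]
  -- A nonintegrable function has Bochner integral `0` by convention, which contradicts the positive
  -- closed form.
  · by_contra hn
    rw [integral_undef hn] at h
    have : 0 < (Real.pi / c) ^ (Module.finrank ℝ V / 2 : ℝ) := by positivity
    exact this.ne h
  · exact Filter.Eventually.of_forall fun v => (Real.exp_pos _).le

theorem lintegral_exp_neg_mul_dotProduct_self (m : ℕ) {c : ℝ} (hc : 0 < c) :
    ∫⁻ b : Fin m → ℝ, ENNReal.ofReal (Real.exp (-c * (b ⬝ᵥ b))) =
      ENNReal.ofReal ((Real.pi / c) ^ (m / 2 : ℝ)) := by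
  have h := lintegral_exp_neg_mul_sq_norm (V := EuclideanSpace ℝ (Fin m)) hc
  rw [finrank_euclideanSpace_fin] at h
  rw [← h, ← (PiLp.volume_preserving_toLp (Fin m)).lintegral_comp]
  · congr 1
    ext b
    rw [EuclideanSpace.norm_sq_eq]
    simp [dotProduct, pow_two]
  · fun_prop

theorem continuous_symMatrix (m : ℕ) :
    Continuous (symMatrix : ({p : Fin m × Fin m // p.1 ≤ p.2} → ℝ) → _) :=
  continuous_matrix fun _ _ => continuous_apply _

theorem isHermitian_symMatrix {m : ℕ} (s : {p : Fin m × Fin m // p.1 ≤ p.2} → ℝ) :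
    (symMatrix s).IsHermitian := by
  ext i j
  simp [symMatrix, min_comm, max_comm]

theorem measurable_det_symMatrix (m : ℕ) :
    Measurable fun s : {p : Fin m × Fin m // p.1 ≤ p.2} → ℝ => (symMatrix s).det :=
  (continuous_symMatrix m).matrix_det.measurable

theorem measurable_trace_symMatrix (m : ℕ) :
    Measurable fun s : {p : Fin m × Fin m // p.1 ≤ p.2} → ℝ => (symMatrix s).trace :=
  (continuous_symMatrix m).matrix_trace.measurable

/-- Positive definite means positive semidefinite, a closed condition, together with nonzero
determinant, an open one. -/
theorem measurableSet_posDef_symMatrix (m : ℕ) :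
    MeasurableSet {s : {p : Fin m × Fin m // p.1 ≤ p.2} → ℝ | (symMatrix s).PosDef} := by
  have h : {s : {p : Fin m × Fin m // p.1 ≤ p.2} → ℝ | (symMatrix s).PosDef} =
      (⋂ x : Fin m → ℝ, {s | 0 ≤ x ⬝ᵥ symMatrix s *ᵥ x}) ∩ {s | (symMatrix s).det ≠ 0} := by
    ext s
    simp only [Set.mem_inter_iff, Set.mem_iInter, Set.mem_ofPred_eq]
    constructor
    · intro h
      refine ⟨fun x => ?_, h.det_pos.ne'⟩
      simpa using (posSemidef_iff_dotProduct_mulVec.mp h.posSemidef).2 x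
    · rintro ⟨h1, h2⟩
      refine (PosSemidef.posDef_iff_det_ne_zero ?_).mpr h2
      exact posSemidef_iff_dotProduct_mulVec.mpr
        ⟨isHermitian_symMatrix s, fun x => by simpa using h1 x⟩
  rw [h]
  refine MeasurableSet.inter (IsClosed.measurableSet (isClosed_iInter fun x => ?_)) ?_
  · refine isClosed_le continuous_const ?_
    exact continuous_const.dotProduct ((continuous_symMatrix m).matrix_mulVec continuous_const)
  · exact (measurable_det_symMatrix m) (measurableSet_singleton (0 : ℝ)).compl

/-- The distribution of the determinant under the measure `exp(-tr r) dr` on the cone of positive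
definite matrices. -/
def siegelDetMeasure (m : ℕ) : Measure ℝ :=
  ((volume.restrict {s : {p : Fin m × Fin m // p.1 ≤ p.2} → ℝ | (symMatrix s).PosDef}).withDensity
    fun s => ENNReal.ofReal (Real.exp (-(symMatrix s).trace))).map fun s => (symMatrix s).det

theorem measurable_ofReal_exp_neg_trace (m : ℕ) :
    Measurable fun s : {p : Fin m × Fin m // p.1 ≤ p.2} → ℝ =>
      ENNReal.ofReal (Real.exp (-(symMatrix s).trace)) :=
  (Real.measurable_exp.comp (measurable_trace_symMatrix m).neg).ennreal_ofReal

instance (m : ℕ) : SFinite (siegelDetMeasure m) := by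
  rw [siegelDetMeasure]
  infer_instance

theorem lintegral_siegelDetMeasure (m : ℕ) {F : ℝ → ℝ≥0∞} (hF : Measurable F) :
    ∫⁻ x, F x ∂siegelDetMeasure m =
      ∫⁻ s in {s : {p : Fin m × Fin m // p.1 ≤ p.2} → ℝ | (symMatrix s).PosDef},
        ENNReal.ofReal (Real.exp (-(symMatrix s).trace)) * F (symMatrix s).det := by
  rw [siegelDetMeasure, lintegral_map hF (measurable_det_symMatrix m),
    lintegral_withDensity_eq_lintegral_mul _ (measurable_ofReal_exp_neg_trace m)
      (g := fun s => F (symMatrix s).det) (hF.comp (measurable_det_symMatrix m))]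
  rfl

theorem siegelGamma_eq_integral (m : ℕ) (β : ℂ) :
    siegelGamma m β = ∫ x, (x : ℂ) ^ (β - ((m : ℂ) + 1) / 2) ∂siegelDetMeasure m := by
  rw [siegelDetMeasure, integral_map (measurable_det_symMatrix m).aemeasurable,
    integral_withDensity_eq_integral_toReal_smul (measurable_ofReal_exp_neg_trace m)
      (by simp), siegelGamma]
  · congr 1
    ext s
    rw [ENNReal.toReal_ofReal (Real.exp_pos _).le, Complex.real_smul]
  · exact (Complex.measurable_ofReal.pow_const _).aestronglyMeasurable

theorem ae_siegelDetMeasure_pos (m : ℕ) : ∀ᵐ x ∂siegelDetMeasure m, 0 < x := by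
  rw [siegelDetMeasure, ae_map_iff (measurable_det_symMatrix m).aemeasurable measurableSet_Ioi]
  refine (withDensity_absolutelyContinuous _ _).ae_le ?_
  refine (ae_restrict_iff' (measurableSet_posDef_symMatrix m)).mpr ?_
  exact Filter.Eventually.of_forall fun s hs => PosDef.det_pos hs

/-- The distribution of the corner in `siegelDetMeasure`. -/
def cornerMeasure (m : ℕ) : Measure ℝ :=
  (volume.restrict (Set.Ioi 0)).withDensity fun a =>
    ENNReal.ofReal (Real.exp (-a) * (Real.pi * a) ^ (m / 2 : ℝ))

theorem lintegral_cornerMeasure (m : ℕ) {F : ℝ → ℝ≥0∞} (hF : Measurable F) :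
    ∫⁻ a, F a ∂cornerMeasure m =
      ∫⁻ a in Set.Ioi 0, ENNReal.ofReal (Real.exp (-a) * (Real.pi * a) ^ (m / 2 : ℝ)) * F a := by
  rw [cornerMeasure, lintegral_withDensity_eq_lintegral_mul _ (by fun_prop) hF]
  rfl

/-- With corner `a`, border `b` and Schur complement `D`, the determinant is `a * det D` and the
trace is `a + |b|²/a + tr D`. The border thus contributes only a Gaussian integral, equal to
`(πa)^(m/2)`, and `a` and `D` separate. -/
theorem lintegral_siegelDetMeasure_succ (m : ℕ) {F : ℝ → ℝ≥0∞} (hF : Measurable F) :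
    ∫⁻ x, F x ∂siegelDetMeasure (m + 1) =
      ∫⁻ a, ∫⁻ x, F (a * x) ∂siegelDetMeasure m ∂cornerMeasure m := by
  have hm1 : Measurable fun a => ∫⁻ x, F (a * x) ∂siegelDetMeasure m :=
    (hF.comp (measurable_fst.mul measurable_snd)).lintegral_prod_right'
  rw [lintegral_cornerMeasure m hm1, lintegral_siegelDetMeasure _ hF,
    ← lintegral_indicator (measurableSet_posDef_symMatrix (m + 1)),
    ← lintegral_indicator measurableSet_Ioi]
  set Ψ : ({p : Fin (m + 1) × Fin (m + 1) // p.1 ≤ p.2} → ℝ) → ℝ≥0∞ :=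
    Set.indicator {s | (symMatrix s).PosDef} fun s =>
      ENNReal.ofReal (Real.exp (-(symMatrix s).trace)) * F (symMatrix s).det with hΨ
  have hΨm : Measurable Ψ :=
    ((measurable_ofReal_exp_neg_trace _).mul (hF.comp (measurable_det_symMatrix _))).indicator
      (measurableSet_posDef_symMatrix _)
  rw [← (measurePreserving_assemble m).lintegral_comp hΨm, Measure.volume_eq_prod, lintegral_prod
    (fun z => Ψ (assemble m z)) (hΨm.comp (assemble m).measurable).aemeasurable]
  congr 1
  ext a
  rw [Measure.volume_eq_prod, lintegral_prod
    (fun z => Ψ (assemble m (a, z))) (hΨm.comp ((assemble m).measurable.comp measurable_prodMk_left)).aemeasurable]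
  by_cases ha : 0 < a
  swap
  · rw [Set.indicator_of_notMem (by simpa using ha)]
    have : ∀ b s, Ψ (assemble m (a, b, s)) = 0 := by
      intro b s
      rw [hΨ, Set.indicator_of_notMem]
      rw [Set.mem_ofPred_eq, symMatrix_assemble]
      intro h
      exact ha (by simpa using h.diag_pos (i := 0))
    simp [this]
  rw [Set.indicator_of_mem (by simpa using ha)]
  -- For fixed `a` and `b`, passing to the Schur complement translates the block by the entries of
  -- `a⁻¹ b b'`, which leaves Lebesgue measure unchanged.
  have hinner : ∀ b : Fin m → ℝ, ∫⁻ s, Ψ (assemble m (a, b, s)) =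
      ENNReal.ofReal (Real.exp (-a)) * ENNReal.ofReal (Real.exp (-a⁻¹ * (b ⬝ᵥ b))) *
        ∫⁻ x, F (a * x) ∂siegelDetMeasure m := by
    intro b
    rw [lintegral_siegelDetMeasure m (F := fun x => F (a * x)) (hF.comp (measurable_const_mul a)),
      ← lintegral_indicator (measurableSet_posDef_symMatrix m), ← lintegral_const_mul,
      ← lintegral_add_right_eq_self _
        (fun p : {p : Fin m × Fin m // p.1 ≤ p.2} => a⁻¹ * (b p.1.1 * b p.1.2))]
    · congr 1
      ext s
      have hsym : symMatrix (s + fun p : {p : Fin m × Fin m // p.1 ≤ p.2} =>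
          a⁻¹ * (b p.1.1 * b p.1.2)) = symMatrix s + a⁻¹ • vecMulVec b b := by
        ext i j
        rcases le_total i j with h | h <;> simp [symMatrix, vecMulVec_apply, h]
        left; ring
      by_cases hs : (symMatrix s).PosDef
      · rw [hΨ, Set.indicator_of_mem, Set.indicator_of_mem (by simpa using hs)]
        · simp only [symMatrix_assemble, hsym, det_bordered ha.ne', trace_bordered,
            trace_add, trace_smul, trace_vecMulVec, smul_eq_mul]
          rw [← mul_assoc, ← ENNReal.ofReal_mul (Real.exp_pos _).le,
            ← ENNReal.ofReal_mul (by positivity), ← Real.exp_add, ← Real.exp_add]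
          congr 3
          ring
        · rw [Set.mem_ofPred_eq, symMatrix_assemble, hsym, posDef_bordered_iff ha]
          exact hs
      · rw [hΨ, Set.indicator_of_notMem, Set.indicator_of_notMem (by simpa using hs), mul_zero]
        rw [Set.mem_ofPred_eq, symMatrix_assemble, hsym, posDef_bordered_iff ha]
        exact hs
    · exact ((measurable_ofReal_exp_neg_trace _).mul ((hF.comp (measurable_const_mul a)).comp
        (measurable_det_symMatrix _))).indicator (measurableSet_posDef_symMatrix _)
  simp_rw [hinner]
  rw [lintegral_mul_const, lintegral_const_mul,
    lintegral_exp_neg_mul_dotProduct_self m (inv_pos.mpr ha), div_inv_eq_mul,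
    ← ENNReal.ofReal_mul (Real.exp_pos _).le]
  · simp only [dotProduct]; fun_prop
  · simp only [dotProduct]; fun_prop

theorem siegelDetMeasure_succ (m : ℕ) :
    siegelDetMeasure (m + 1) =
      ((cornerMeasure m).prod (siegelDetMeasure m)).map fun p => p.1 * p.2 := by
  have : SFinite (cornerMeasure m) := by rw [cornerMeasure]; infer_instance
  refine Measure.ext_of_lintegral _ fun F hF => ?_
  have hmul : Measurable fun p : ℝ × ℝ => p.1 * p.2 := measurable_fst.mul measurable_snd
  rw [lintegral_siegelDetMeasure_succ m hF, lintegral_map hF hmul,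
    lintegral_prod (fun p => F (p.1 * p.2)) (hF.comp hmul).aemeasurable]

theorem siegelDetMeasure_zero : siegelDetMeasure 0 = Measure.dirac 1 := by
  refine Measure.ext_of_lintegral _ fun F hF => ?_
  rw [lintegral_siegelDetMeasure 0 hF, lintegral_dirac' _ hF]
  have : {s : {p : Fin 0 × Fin 0 // p.1 ≤ p.2} → ℝ | (symMatrix s).PosDef} = Set.univ := by
    ext s
    simp only [Set.mem_ofPred_eq, Set.mem_univ, iff_true]
    exact PosDef.of_dotProduct_mulVec_pos (isHermitian_symMatrix s)
      fun x hx => absurd (Subsingleton.elim x 0) hx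
  rw [this, Measure.restrict_univ, volume_pi, Measure.pi_of_empty, lintegral_dirac]
  simp [Matrix.trace]

/-! ### Moments of the determinant law, as products of gamma integrals. -/

theorem ae_cornerMeasure_pos (m : ℕ) : ∀ᵐ a ∂cornerMeasure m, 0 < a := by
  rw [cornerMeasure]
  refine (withDensity_absolutelyContinuous _ _).ae_le ?_
  exact ae_restrict_mem measurableSet_Ioi

instance (m : ℕ) : SFinite (cornerMeasure m) := by
  rw [cornerMeasure]
  infer_instance

theorem integral_cpow_siegelDetMeasure_succ (m : ℕ) (t : ℂ) :
    ∫ x, (x : ℂ) ^ t ∂siegelDetMeasure (m + 1) =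
      (∫ a, (a : ℂ) ^ t ∂cornerMeasure m) * ∫ x, (x : ℂ) ^ t ∂siegelDetMeasure m := by
  have hmul : Measurable fun p : ℝ × ℝ => p.1 * p.2 := measurable_fst.mul measurable_snd
  rw [siegelDetMeasure_succ, integral_map hmul.aemeasurable
    (Complex.measurable_ofReal.pow_const _).aestronglyMeasurable, ← integral_prod_mul]
  refine integral_congr_ae ?_
  have h1 : ∀ᵐ p ∂(cornerMeasure m).prod (siegelDetMeasure m), 0 < p.1 :=
    Measure.quasiMeasurePreserving_fst.ae (ae_cornerMeasure_pos m)
  have h2 : ∀ᵐ p ∂(cornerMeasure m).prod (siegelDetMeasure m), 0 < p.2 :=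
    Measure.quasiMeasurePreserving_snd.ae (ae_siegelDetMeasure_pos m)
  filter_upwards [h1, h2] with p hp1 hp2
  rw [Complex.ofReal_mul, Complex.mul_cpow_ofReal_nonneg hp1.le hp2.le]

theorem lintegral_rpow_siegelDetMeasure_succ (m : ℕ) (t : ℝ) :
    ∫⁻ x, ENNReal.ofReal (x ^ t) ∂siegelDetMeasure (m + 1) =
      (∫⁻ a, ENNReal.ofReal (a ^ t) ∂cornerMeasure m) *
        ∫⁻ x, ENNReal.ofReal (x ^ t) ∂siegelDetMeasure m := by
  rw [lintegral_siegelDetMeasure_succ m (by fun_prop), ← lintegral_mul_const _ (by fun_prop)]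
  refine lintegral_congr_ae ?_
  filter_upwards [ae_cornerMeasure_pos m] with a ha
  rw [← lintegral_const_mul _ (by fun_prop)]
  refine lintegral_congr_ae ?_
  filter_upwards [ae_siegelDetMeasure_pos m] with x hx
  rw [Real.mul_rpow ha.le hx.le, ENNReal.ofReal_mul (by positivity)]

theorem integral_cpow_cornerMeasure (m : ℕ) {t : ℂ} (ht : -1 < t.re) :
    ∫ a, (a : ℂ) ^ t ∂cornerMeasure m =
      ((Real.pi ^ (m / 2 : ℝ) : ℝ) : ℂ) * Complex.Gamma (t + m / 2 + 1) := by
  rw [Complex.Gamma_eq_integral (by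
    have : (0 : ℝ) ≤ (m : ℝ) / 2 := by positivity
    have h2 : ((m : ℂ) / 2).re = (m : ℝ) / 2 := by simp
    simp only [Complex.add_re, h2, Complex.one_re]
    linarith), Complex.GammaIntegral, cornerMeasure,
    integral_withDensity_eq_integral_toReal_smul (by fun_prop) (by simp), ← integral_const_mul]
  refine setIntegral_congr_fun measurableSet_Ioi fun a ha => ?_
  have ha' : (0 : ℝ) < a := ha
  rw [ENNReal.toReal_ofReal (by positivity), Complex.real_smul,
    Real.mul_rpow Real.pi_pos.le ha'.le, Complex.ofReal_mul, Complex.ofReal_mul,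
    Complex.ofReal_cpow ha'.le, add_sub_cancel_right,
    Complex.cpow_add _ _ (Complex.ofReal_ne_zero.mpr ha'.ne')]
  push_cast
  ring

theorem integral_cpow_siegelDetMeasure_ne_zero (m : ℕ) {t : ℂ} (ht : -1 < t.re) :
    ∫ x, (x : ℂ) ^ t ∂siegelDetMeasure m ≠ 0 := by
  induction m with
  | zero => simp [siegelDetMeasure_zero]
  | succ m ih =>
    rw [integral_cpow_siegelDetMeasure_succ, integral_cpow_cornerMeasure m ht]
    refine mul_ne_zero (mul_ne_zero ?_ (Complex.Gamma_ne_zero_of_re_pos ?_)) ih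
    · exact_mod_cast (Real.rpow_pos_of_pos Real.pi_pos _).ne'
    · have : (0 : ℝ) ≤ (m : ℝ) / 2 := by positivity
      have h2 : ((m : ℂ) / 2).re = (m : ℝ) / 2 := by simp
      simp only [Complex.add_re, h2, Complex.one_re]
      linarith

/-- The gamma function has no zeros in the right half plane, hence neither does the product of
shifted gamma factors. This allows division by the denominators of the constants. -/
theorem siegelGamma_ne_zero (m : ℕ) {β : ℂ} (hβ : ((m : ℝ) - 1) / 2 < β.re) :
    siegelGamma m β ≠ 0 := by
  rw [siegelGamma_eq_integral]
  refine integral_cpow_siegelDetMeasure_ne_zero m ?_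
  have h : (((m : ℂ) + 1) / 2).re = ((m : ℝ) + 1) / 2 := by simp
  rw [Complex.sub_re, h]
  linarith

theorem lintegral_rpow_cornerMeasure (m : ℕ) (t : ℝ) :
    ∫⁻ a, ENNReal.ofReal (a ^ t) ∂cornerMeasure m =
      ENNReal.ofReal (Real.pi ^ (m / 2 : ℝ)) *
        ∫⁻ a in Set.Ioi 0, ENNReal.ofReal (Real.exp (-a) * a ^ (t + m / 2 : ℝ)) := by
  rw [lintegral_cornerMeasure m (by fun_prop), ← lintegral_const_mul _ (by fun_prop)]
  refine setLIntegral_congr_fun measurableSet_Ioi fun a ha => ?_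
  have ha' : (0 : ℝ) < a := ha
  rw [← ENNReal.ofReal_mul (by positivity), ← ENNReal.ofReal_mul (by positivity),
    Real.mul_rpow Real.pi_pos.le ha'.le, Real.rpow_add ha']
  congr 1
  ring

theorem lintegral_rpow_siegelDetMeasure_ne_zero (m : ℕ) (t : ℝ) :
    ∫⁻ x, ENNReal.ofReal (x ^ t) ∂siegelDetMeasure m ≠ 0 := by
  intro h
  rw [lintegral_eq_zero_iff (by fun_prop)] at h
  have hbot : ∀ᵐ x ∂siegelDetMeasure m, False := by
    filter_upwards [h, ae_siegelDetMeasure_pos m] with x hx hpos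
    have : 0 < x ^ t := Real.rpow_pos_of_pos hpos t
    simp at hx
    linarith
  have hzero : siegelDetMeasure m = 0 := by
    simpa using hbot
  -- The zeroth moment is the total mass, so the measure is not zero.
  have := integral_cpow_siegelDetMeasure_ne_zero m (t := 0) (by simp)
  rw [hzero] at this
  simp at this

theorem lintegral_rpow_siegelDetMeasure_lt_top (m : ℕ) {t : ℝ} (ht : -1 < t) :
    ∫⁻ x, ENNReal.ofReal (x ^ t) ∂siegelDetMeasure m < ∞ := by
  induction m with
  | zero => simp [siegelDetMeasure_zero]
  | succ m ih =>
    rw [lintegral_rpow_siegelDetMeasure_succ, lintegral_rpow_cornerMeasure]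
    refine ENNReal.mul_lt_top (ENNReal.mul_lt_top ENNReal.ofReal_lt_top ?_) ih
    have h := Real.GammaIntegral_convergent (s := t + m / 2 + 1) (by
      have : (0 : ℝ) ≤ (m : ℝ) / 2 := by positivity
      linarith)
    rw [add_sub_cancel_right] at h
    exact h.lintegral_lt_top

/-- The divergence comes from the innermost corner, whose factor is `∫ exp(-a) a⁻¹ da`; the other
factors need only be nonzero. -/
theorem lintegral_inv_siegelDetMeasure (m : ℕ) :
    ∫⁻ x, ENNReal.ofReal (x ^ (-1 : ℝ)) ∂siegelDetMeasure (m + 1) = ∞ := by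
  induction m with
  | succ m ih =>
    rw [lintegral_rpow_siegelDetMeasure_succ, ih, ENNReal.mul_top]
    rw [lintegral_rpow_cornerMeasure]
    refine mul_ne_zero (by simp; positivity) ?_
    intro h
    rw [lintegral_eq_zero_iff (by fun_prop)] at h
    have hbot : ∀ᵐ x ∂(volume.restrict (Set.Ioi (0 : ℝ))), False := by
      filter_upwards [h, ae_restrict_mem measurableSet_Ioi] with x hx hpos
      have hpos' : 0 < x := hpos
      have : 0 < Real.exp (-x) * x ^ ((-1 : ℝ) + ((m + 1 : ℕ) : ℝ) / 2) := by positivity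
      simp only [Pi.zero_apply, ENNReal.ofReal_eq_zero] at hx
      linarith
    rw [Filter.eventually_false_iff_eq_bot, ae_eq_bot, Measure.restrict_eq_zero] at hbot
    simp at hbot
  | zero =>
    rw [lintegral_rpow_siegelDetMeasure_succ, siegelDetMeasure_zero, lintegral_rpow_cornerMeasure]
    have key : ∫⁻ a in Set.Ioi (0 : ℝ), ENNReal.ofReal (Real.exp (-a) * a ^ (-1 : ℝ)) = ∞ := by
      by_contra hfin
      have hint : IntegrableOn (fun a : ℝ => Real.exp (-a) * a ^ (-1 : ℝ)) (Set.Ioi 0) := by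
        refine (lintegral_ofReal_ne_top_iff_integrable (by fun_prop) ?_).mp hfin
        refine (ae_restrict_iff' measurableSet_Ioi).mpr (Filter.Eventually.of_forall fun a ha => ?_)
        have ha' : (0 : ℝ) < a := ha
        simp only [Pi.zero_apply]
        positivity
      -- On `(0, 1)` the factor `exp 1 * exp(-a)` is at least `1`, so integrability of `exp(-a) a⁻¹`
      -- would pass to `a⁻¹`.
      have hint1 : IntegrableOn (fun a : ℝ => a ^ (-1 : ℝ)) (Set.Ioo 0 1) := by
        refine Integrable.mono' ((hint.mono_set Set.Ioo_subset_Ioi_self).const_mul (Real.exp 1))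
          (by fun_prop) ?_
        refine (ae_restrict_iff' measurableSet_Ioo).mpr (Filter.Eventually.of_forall fun a ha => ?_)
        have ha0 : (0 : ℝ) < a := ha.1
        rw [Real.norm_of_nonneg (by positivity), ← mul_assoc, ← Real.exp_add]
        refine le_mul_of_one_le_left (by positivity) (Real.one_le_exp ?_)
        linarith [ha.2]
      rw [intervalIntegral.integrableOn_Ioo_rpow_iff one_pos] at hint1
      exact lt_irrefl _ hint1
    simp only [Nat.cast_zero, zero_div, add_zero, key]
    simp

/-! ### Polar coordinates. -/

theorem lintegral_fun_norm {E : Type*} [NormedAddCommGroup E] [NormedSpace ℝ E]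
    [FiniteDimensional ℝ E] [MeasurableSpace E] [BorelSpace E] [Nontrivial E] (μ : Measure E)
    [μ.IsAddHaarMeasure] {f : ℝ → ℝ≥0∞} (hf : Measurable f) :
    ∫⁻ x, f ‖x‖ ∂μ = μ.toSphere Set.univ *
      ∫⁻ y in Set.Ioi (0 : ℝ), ENNReal.ofReal (y ^ (Module.finrank ℝ E - 1)) * f y := by
  have h1 : ∫⁻ x, f ‖x‖ ∂μ = ∫⁻ x : ({(0)}ᶜ : Set E), f (‖x.1‖) ∂(μ.comap (↑)) := by
    rw [lintegral_subtype_comap (measurableSet_singleton _).compl fun x => f (‖x‖),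
      restrict_compl_singleton]
  have h2 := μ.measurePreserving_homeomorphUnitSphereProd.lintegral_comp
    (f := f ∘ Subtype.val ∘ Prod.snd)
    (hf.comp (measurable_subtype_coe.comp measurable_snd))
  have h3 : ∫⁻ z, (f ∘ Subtype.val ∘ Prod.snd) z
      ∂(μ.toSphere.prod (Measure.volumeIoiPow (Module.finrank ℝ E - 1))) =
      μ.toSphere Set.univ *
        ∫⁻ y, f (y : Set.Ioi (0 : ℝ)) ∂(Measure.volumeIoiPow (Module.finrank ℝ E - 1)) := by
    have := lintegral_prod_mul (μ := μ.toSphere)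
      (ν := Measure.volumeIoiPow (Module.finrank ℝ E - 1)) (f := fun _ => 1)
      (g := fun y => f (y : Set.Ioi (0 : ℝ))) aemeasurable_const
      (hf.comp measurable_subtype_coe).aemeasurable
    simpa using this
  rw [h1, ← lintegral_subtype_comap measurableSet_Ioi]
  refine Eq.trans ?_ ((h2.trans h3).trans ?_)
  · simp
  · rw [Measure.volumeIoiPow, lintegral_withDensity_eq_lintegral_mul _ (by fun_prop)
      (g := fun y => f (y : Set.Ioi (0 : ℝ))) (hf.comp measurable_subtype_coe)]
    rfl

theorem lintegral_comp_sq_Ioi (F : ℝ → ℝ≥0∞) :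
    ∫⁻ a in Set.Ioi (0 : ℝ), F a =
      ∫⁻ y in Set.Ioi (0 : ℝ), ENNReal.ofReal (2 * y) * F (y ^ 2) := by
  have himg : (fun y : ℝ => y ^ 2) '' Set.Ioi 0 = Set.Ioi 0 := by
    ext a
    constructor
    · rintro ⟨y, hy, rfl⟩
      have hy' : (0 : ℝ) < y := hy
      exact pow_pos hy' 2
    · intro ha
      have ha' : (0 : ℝ) < a := ha
      exact ⟨√a, Real.sqrt_pos.mpr ha', Real.sq_sqrt ha'.le⟩
  have h := lintegral_image_eq_lintegral_abs_deriv_mul (s := Set.Ioi (0 : ℝ))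
    (f := fun y : ℝ => y ^ 2) (f' := fun y => 2 * y) measurableSet_Ioi
    (fun y _ => by simpa using (hasDerivAt_pow 2 y).hasDerivWithinAt)
    (fun x hx y hy hxy => by
      have hx' : (0 : ℝ) < x := hx
      have hy' : (0 : ℝ) < y := hy
      exact (pow_left_inj₀ hx'.le hy'.le two_ne_zero).mp hxy) F
  rw [himg] at h
  rw [h]
  refine setLIntegral_congr_fun measurableSet_Ioi fun y hy => ?_
  have hy' : (0 : ℝ) < y := hy
  rw [abs_of_pos (by positivity)]

/-- Polar coordinates for functions of the squared Euclidean length. -/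
theorem exists_lintegral_dotProduct_self (n : ℕ) : ∃ c : ℝ≥0∞, c ≠ 0 ∧ c ≠ ∞ ∧
    ∀ F : ℝ → ℝ≥0∞, Measurable F → ∫⁻ x : Fin (n + 1) → ℝ, F (x ⬝ᵥ x) =
      c * ∫⁻ a in Set.Ioi (0 : ℝ), ENNReal.ofReal (a ^ (((n : ℝ) - 1) / 2)) * F a := by
  set σ := (volume : Measure (EuclideanSpace ℝ (Fin (n + 1)))).toSphere Set.univ with hσ
  have hσ0 : σ ≠ 0 := by
    rw [hσ, Measure.toSphere_apply_univ]
    refine mul_ne_zero (by simp) ?_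
    exact (Metric.measure_ball_pos _ _ one_pos).ne'
  have hσt : σ ≠ ∞ := measure_ne_top _ _
  -- The total mass of the sphere, halved by `a = y²`: `y^n dy = (1/2) a^((n-1)/2) da`.
  refine ⟨σ * ENNReal.ofReal (1 / 2), mul_ne_zero hσ0 (by simp),
    ENNReal.mul_ne_top hσt ENNReal.ofReal_ne_top, fun F hF => ?_⟩
  have h1 : ∫⁻ x : Fin (n + 1) → ℝ, F (x ⬝ᵥ x) =
      ∫⁻ x : EuclideanSpace ℝ (Fin (n + 1)), F (‖x‖ ^ 2) := by
    rw [← (PiLp.volume_preserving_toLp (Fin (n + 1))).lintegral_comp (by fun_prop)]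
    congr 1
    ext b
    rw [EuclideanSpace.norm_sq_eq]
    simp [dotProduct, pow_two]
  rw [h1, lintegral_fun_norm volume (f := fun y => F (y ^ 2)) (by fun_prop), mul_assoc]
  congr 1
  rw [lintegral_comp_sq_Ioi fun a => ENNReal.ofReal (a ^ (((n : ℝ) - 1) / 2)) * F a,
    ← lintegral_const_mul _ (by fun_prop)]
  refine setLIntegral_congr_fun measurableSet_Ioi fun y hy => ?_
  have hy' : (0 : ℝ) < y := hy
  have e : (y ^ 2) ^ (((n : ℝ) - 1) / 2) = y ^ n / y := by
    rw [← Real.rpow_natCast y 2, ← Real.rpow_mul hy'.le]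
    have : ((2 : ℕ) : ℝ) * (((n : ℝ) - 1) / 2) = n - 1 := by push_cast; ring
    rw [this, Real.rpow_sub_one hy'.ne', Real.rpow_natCast]
  rw [finrank_euclideanSpace_fin, Nat.add_sub_cancel, e, ← mul_assoc, ← mul_assoc,
    ← ENNReal.ofReal_mul (by positivity), ← ENNReal.ofReal_mul (by positivity)]
  congr 2
  field_simp

/-! ### Gram determinants of Gaussian vectors. -/

/-- The Gram matrix of a family of vectors. -/
def dotGram {m n : ℕ} (X : Fin m → Fin n → ℝ) : Matrix (Fin m) (Fin m) ℝ :=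
  Matrix.of X * (Matrix.of X)ᵀ

theorem dotGram_apply {m n : ℕ} (X : Fin m → Fin n → ℝ) (i j : Fin m) :
    dotGram X i j = X i ⬝ᵥ X j := rfl

/-- The Gaussian weight of a family of vectors. -/
def gaussWeight {m n : ℕ} (X : Fin m → Fin n → ℝ) : ℝ≥0∞ :=
  ENNReal.ofReal (Real.exp (-(dotGram X).trace))

theorem continuous_dotGram (m n : ℕ) :
    Continuous (dotGram : (Fin m → Fin n → ℝ) → Matrix (Fin m) (Fin m) ℝ) :=
  continuous_matrix fun i j => Continuous.dotProduct (A := fun X : Fin m → Fin n → ℝ => X i)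
    (B := fun X => X j) (continuous_apply i) (continuous_apply j)

theorem measurable_det_dotGram (m n : ℕ) :
    Measurable fun X : Fin m → Fin n → ℝ => (dotGram X).det :=
  (continuous_dotGram m n).matrix_det.measurable

theorem measurable_gaussWeight (m n : ℕ) :
    Measurable (gaussWeight : (Fin m → Fin n → ℝ) → ℝ≥0∞) :=
  (Real.measurable_exp.comp (continuous_dotGram m n).matrix_trace.measurable.neg).ennreal_ofReal

theorem lintegral_gaussWeight_ne_zero (m n : ℕ) : ∫⁻ X : Fin m → Fin n → ℝ, gaussWeight X ≠ 0 := by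
  intro h
  rw [lintegral_eq_zero_iff (measurable_gaussWeight m n)] at h
  obtain ⟨X, hX⟩ := h.exists
  simp only [gaussWeight, Pi.zero_apply, ENNReal.ofReal_eq_zero] at hX
  exact absurd hX (not_le.mpr (Real.exp_pos _))

theorem lintegral_gaussWeight_ne_top (m n : ℕ) : ∫⁻ X : Fin m → Fin n → ℝ, gaussWeight X ≠ ∞ := by
  have h1 : Integrable fun x : Fin n → ℝ => Real.exp (-(x ⬝ᵥ x)) := by
    refine (lintegral_ofReal_ne_top_iff_integrable
      (by simp only [dotProduct]; fun_prop) (ae_of_all _ fun x => (Real.exp_pos _).le)).mp ?_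
    have := lintegral_exp_neg_mul_dotProduct_self n one_pos
    simp only [neg_mul, one_mul] at this
    rw [this]
    exact ENNReal.ofReal_ne_top
  have h2 : Integrable fun X : Fin m → Fin n → ℝ => ∏ i, Real.exp (-(X i ⬝ᵥ X i)) :=
    Integrable.fintype_prod fun _ => h1
  have h3 : (gaussWeight : (Fin m → Fin n → ℝ) → ℝ≥0∞) =
      fun X => ENNReal.ofReal (∏ i, Real.exp (-(X i ⬝ᵥ X i))) := by
    ext X
    rw [gaussWeight, ← Real.exp_sum, Finset.sum_neg_distrib]
    rfl
  rw [h3]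
  exact h2.lintegral_lt_top.ne

theorem measurePreserving_mulVec_orthogonal {n : ℕ} (O : orthogonalGroup (Fin n) ℝ) :
    MeasurePreserving fun x : Fin n → ℝ => (O : Matrix (Fin n) (Fin n) ℝ) *ᵥ x := by
  have hdet : |(O : Matrix (Fin n) (Fin n) ℝ).det| = 1 := by
    have h := congr_arg Matrix.det ((mem_orthogonalGroup_iff (Fin n) ℝ).mp O.2)
    rw [det_mul, det_one] at h
    have h' : (O : Matrix (Fin n) (Fin n) ℝ).det * (O : Matrix (Fin n) (Fin n) ℝ).det = 1 := by
      simpa [star_eq_conjTranspose, det_conjTranspose] using h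
    have := abs_mul_abs_self (O : Matrix (Fin n) (Fin n) ℝ).det
    rw [h'] at this
    nlinarith [abs_nonneg (O : Matrix (Fin n) (Fin n) ℝ).det]
  refine ⟨Continuous.measurable (by fun_prop), ?_⟩
  have h0 : (O : Matrix (Fin n) (Fin n) ℝ).det ≠ 0 := by
    intro h
    simp [h] at hdet
  have := Real.map_matrix_volume_pi_eq_smul_volume_pi h0
  rw [abs_inv, hdet] at this
  rw [ENNReal.ofReal_eq_one.mpr (by norm_num), one_smul] at this
  exact this

theorem measurePreserving_orthogonal {m n : ℕ} (O : orthogonalGroup (Fin n) ℝ) :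
    MeasurePreserving fun (X : Fin m → Fin n → ℝ) i =>
      (O : Matrix (Fin n) (Fin n) ℝ) *ᵥ X i :=
  volume_preserving_pi fun _ => measurePreserving_mulVec_orthogonal O

theorem dotGram_orthogonal {m n : ℕ} (O : orthogonalGroup (Fin n) ℝ) (X : Fin m → Fin n → ℝ) :
    dotGram (fun i => (O : Matrix (Fin n) (Fin n) ℝ) *ᵥ X i) = dotGram X := by
  ext i j
  have h := (mem_orthogonalGroup_iff' (Fin n) ℝ).mp O.2
  change (O : Matrix (Fin n) (Fin n) ℝ)ᵀ * (O : Matrix (Fin n) (Fin n) ℝ) = 1 at h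
  rw [dotGram_apply, dotGram_apply, dotProduct_mulVec, vecMul_mulVec, h, vecMul_one]

/-- Splitting the coordinates of each vector of a family. -/
def splitCoords (m k l : ℕ) : (Fin m → Fin (k + l) → ℝ) ≃ᵐ
    (Fin m → Fin k → ℝ) × (Fin m → Fin l → ℝ) :=
  (MeasurableEquiv.piCongrRight fun _ : Fin m =>
    (MeasurableEquiv.piCongrLeft (fun _ => ℝ) finSumFinEquiv.symm).trans
      (MeasurableEquiv.sumPiEquivProdPi fun _ : Fin k ⊕ Fin l => ℝ)).trans
    (MeasurableEquiv.arrowProdEquivProdArrow _ _ _)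

theorem measurePreserving_splitCoords (m k l : ℕ) : MeasurePreserving (splitCoords m k l) := by
  refine MeasurePreserving.trans (volume_preserving_pi (f := fun _ =>
    (MeasurableEquiv.piCongrLeft (fun _ => ℝ) finSumFinEquiv.symm).trans
      (MeasurableEquiv.sumPiEquivProdPi fun _ : Fin k ⊕ Fin l => ℝ)) fun _ => ?_)
    (volume_measurePreserving_arrowProdEquivProdArrow _ _ _)
  exact (volume_measurePreserving_piCongrLeft _ _).trans
    (volume_measurePreserving_sumPiEquivProdPi _)

theorem splitCoords_apply {m k l : ℕ} (X : Fin m → Fin (k + l) → ℝ) :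
    splitCoords m k l X =
      (fun i j => X i (Fin.castAdd l j), fun i j => X i (Fin.natAdd k j)) := by
  have h : ∀ i (s : Fin k ⊕ Fin l), (MeasurableEquiv.piCongrLeft (fun _ : Fin k ⊕ Fin l => ℝ)
      finSumFinEquiv.symm) (X i) s = X i (finSumFinEquiv s) := by
    intro i s
    obtain ⟨j, rfl⟩ := finSumFinEquiv.symm.surjective s
    rw [MeasurableEquiv.coe_piCongrLeft, Equiv.piCongrLeft_apply_apply]
    simp
  refine Prod.ext ?_ ?_
  · ext i j
    exact h i (Sum.inl j)
  · ext i j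
    exact h i (Sum.inr j)

theorem dotGram_eq_add {m k l : ℕ} (X : Fin m → Fin (k + l) → ℝ) :
    dotGram X = dotGram (splitCoords m k l X).1 + dotGram (splitCoords m k l X).2 := by
  ext i j
  rw [splitCoords_apply, Matrix.add_apply, dotGram_apply, dotGram_apply, dotGram_apply]
  simp [dotProduct, Fin.sum_univ_add]

theorem gaussWeight_eq_mul {m k l : ℕ} (X : Fin m → Fin (k + l) → ℝ) :
    gaussWeight X = gaussWeight (splitCoords m k l X).1 * gaussWeight (splitCoords m k l X).2 := by
  rw [gaussWeight, gaussWeight, gaussWeight, dotGram_eq_add, trace_add, neg_add, Real.exp_add,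
    ENNReal.ofReal_mul (Real.exp_pos _).le]

/-- Integrating out the coordinates on which a function does not depend. -/
theorem lintegral_gaussWeight_mul_splitCoords {m k l : ℕ} {F : (Fin m → Fin k → ℝ) → ℝ≥0∞}
    (hF : Measurable F) :
    ∫⁻ X : Fin m → Fin (k + l) → ℝ, gaussWeight X * F (splitCoords m k l X).1 =
      (∫⁻ Z : Fin m → Fin l → ℝ, gaussWeight Z) *
        ∫⁻ Y : Fin m → Fin k → ℝ, gaussWeight Y * F Y := by
  have hg : Measurable fun Y : Fin m → Fin k → ℝ => gaussWeight Y * F Y :=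
    (measurable_gaussWeight m k).mul hF
  have h := (measurePreserving_splitCoords m k l).lintegral_comp
    (f := fun p => (gaussWeight p.1 * F p.1) * gaussWeight p.2)
    ((hg.comp measurable_fst).mul ((measurable_gaussWeight m l).comp measurable_snd))
  rw [Measure.volume_eq_prod, lintegral_prod_mul hg.aemeasurable
    (measurable_gaussWeight m l).aemeasurable] at h
  rw [mul_comm, ← h]
  congr 1
  ext X
  rw [gaussWeight_eq_mul]
  ring

/-- Every vector is rotated to a nonnegative multiple of the last basis vector. -/
theorem exists_orthogonal_mulVec_eq_single_last {n : ℕ} (x : Fin (n + 1) → ℝ) :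
    ∃ O : orthogonalGroup (Fin (n + 1)) ℝ, ∃ r : ℝ,
      (O : Matrix (Fin (n + 1)) (Fin (n + 1)) ℝ) *ᵥ x = Pi.single (Fin.last n) r := by
  set r := √(x ⬝ᵥ x) with hr
  set y : Fin (n + 1) → ℝ := Pi.single (Fin.last n) r with hy
  have hyy : y ⬝ᵥ y = x ⬝ᵥ x := by
    have h0 : 0 ≤ x ⬝ᵥ x := Finset.sum_nonneg fun i _ => mul_self_nonneg _
    simp [hy, hr, Real.mul_self_sqrt h0]
  set v := x - y with hv
  by_cases hv0 : v = 0
  · refine ⟨1, r, ?_⟩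
    rw [OneMemClass.coe_one, one_mulVec]
    exact sub_eq_zero.mp hv0
  have hvv : v ⬝ᵥ v ≠ 0 := fun h => hv0 (dotProduct_self_eq_zero.mp h)
  have hvx : v ⬝ᵥ v = 2 * (v ⬝ᵥ x) := by
    simp only [hv, sub_dotProduct, dotProduct_sub, hyy, dotProduct_comm x y]
    ring
  -- The Householder reflection along `x - y`, which exchanges the equally long vectors `x` and `y`.
  refine ⟨⟨1 - (2 / (v ⬝ᵥ v)) • vecMulVec v v, ?_⟩, r, ?_⟩
  · rw [mem_orthogonalGroup_iff']
    rw [transpose_sub, transpose_one, transpose_smul, transpose_vecMulVec, sub_mul, one_mul, mul_sub,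
      mul_one, smul_mul_smul_comm, vecMulVec_mul_vecMulVec, vecMulVec_smul, smul_smul]
    have : 2 / (v ⬝ᵥ v) * (2 / (v ⬝ᵥ v)) * (v ⬝ᵥ v) = 2 / (v ⬝ᵥ v) + 2 / (v ⬝ᵥ v) := by
      field_simp
      norm_num
    rw [this, add_smul]
    abel
  · change (1 - (2 / (v ⬝ᵥ v)) • vecMulVec v v) *ᵥ x = y
    rw [sub_mulVec, one_mulVec, smul_mulVec, vecMulVec_mulVec, op_smul_eq_smul, smul_smul]
    have : 2 / (v ⬝ᵥ v) * (v ⬝ᵥ x) = 1 := by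
      rw [hvx] at hvv ⊢
      have : v ⬝ᵥ x ≠ 0 := right_ne_zero_of_mul hvv
      field_simp
    rw [this, one_smul, hv, sub_sub_cancel]

theorem measurable_finCons {m : ℕ} {E : Type*} [MeasurableSpace E] :
    Measurable fun p : E × (Fin m → E) => (Fin.cons p.1 p.2 : Fin (m + 1) → E) := by
  refine measurable_pi_iff.mpr fun i => ?_
  refine Fin.cases ?_ (fun i => ?_) i
  · exact measurable_fst
  · exact (measurable_pi_apply i).comp measurable_snd

theorem dotGram_cons {m n : ℕ} (x : Fin n → ℝ) (X : Fin m → Fin n → ℝ) :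
    dotGram (Fin.cons x X : Fin (m + 1) → Fin n → ℝ) =
      bordered (x ⬝ᵥ x) (fun i => x ⬝ᵥ X i) (dotGram X) := by
  ext i j
  refine Fin.cases ?_ (fun i => ?_) i <;> refine Fin.cases ?_ (fun j => ?_) j
  · simp [dotGram_apply]
  · simp [dotGram_apply]
  · simp [dotGram_apply, dotProduct_comm x]
  · simp [dotGram_apply]

theorem gaussWeight_cons {m n : ℕ} (x : Fin n → ℝ) (X : Fin m → Fin n → ℝ) :
    gaussWeight (Fin.cons x X : Fin (m + 1) → Fin n → ℝ) =
      ENNReal.ofReal (Real.exp (-(x ⬝ᵥ x))) * gaussWeight X := by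
  rw [gaussWeight, gaussWeight, dotGram_cons, trace_bordered, neg_add, Real.exp_add,
    ENNReal.ofReal_mul (Real.exp_pos _).le]

theorem gaussWeight_orthogonal {m n : ℕ} (O : orthogonalGroup (Fin n) ℝ)
    (X : Fin m → Fin n → ℝ) :
    gaussWeight (fun i => (O : Matrix (Fin n) (Fin n) ℝ) *ᵥ X i) = gaussWeight X := by
  rw [gaussWeight, dotGram_orthogonal, gaussWeight]

/-- The Schur complement of the corner is the Gram matrix of the projections orthogonal to the first
vector; here this projection drops the last coordinate. -/
theorem det_dotGram_cons_single_last {m n : ℕ} {r : ℝ} (hr : r ≠ 0)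
    (X : Fin m → Fin (n + 1) → ℝ) :
    (dotGram (Fin.cons (Pi.single (Fin.last n) r) X : Fin (m + 1) → Fin (n + 1) → ℝ)).det =
      r ^ 2 * (dotGram (splitCoords m n 1 X).1).det := by
  have h : dotGram X = dotGram (splitCoords m n 1 X).1 + (r ^ 2)⁻¹ •
      vecMulVec (fun i => r * X i (Fin.last n)) (fun i => r * X i (Fin.last n)) := by
    rw [dotGram_eq_add (k := n) (l := 1) X]
    congr 1
    ext i j
    rw [splitCoords_apply, dotGram_apply]
    have : Fin.natAdd n (0 : Fin 1) = Fin.last n := rfl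
    simp only [dotProduct, Fin.sum_univ_one, Matrix.smul_apply, vecMulVec_apply, smul_eq_mul, this]
    field_simp
  rw [dotGram_cons]
  have e1 : (Pi.single (Fin.last n) r : Fin (n + 1) → ℝ) ⬝ᵥ Pi.single (Fin.last n) r = r ^ 2 := by
    simp [pow_two]
  have e2 : (fun i => (Pi.single (Fin.last n) r : Fin (n + 1) → ℝ) ⬝ᵥ X i) =
      fun i => r * X i (Fin.last n) := by
    ext i
    simp
  rw [e1, e2, h, det_bordered (pow_ne_zero 2 hr)]

/-- Integrating the Gram determinant with the first vector kept fixed. -/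
theorem lintegral_det_dotGram_cons {m n : ℕ} {x : Fin (n + 1) → ℝ} (hx : x ≠ 0)
    {F : ℝ → ℝ≥0∞} (hF : Measurable F) :
    ∫⁻ X : Fin m → Fin (n + 1) → ℝ, gaussWeight X *
        F (dotGram (Fin.cons x X : Fin (m + 1) → Fin (n + 1) → ℝ)).det =
      (∫⁻ Z : Fin m → Fin 1 → ℝ, gaussWeight Z) *
        ∫⁻ Y : Fin m → Fin n → ℝ, gaussWeight Y * F ((x ⬝ᵥ x) * (dotGram Y).det) := by
  -- Lebesgue measure, the Gaussian weight and the Gram matrix are all rotation invariant, so `x`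
  -- may be placed on the last axis.
  obtain ⟨O, r, hOx⟩ := exists_orthogonal_mulVec_eq_single_last x
  have hxx : x ⬝ᵥ x = r ^ 2 := by
    have h := congr_fun (congr_fun (dotGram_orthogonal O (fun _ : Fin 1 => x)) 0) 0
    rw [dotGram_apply, dotGram_apply, hOx] at h
    rw [← h]
    simp [pow_two]
  have hr : r ≠ 0 := by
    rintro rfl
    rw [zero_pow two_ne_zero, dotProduct_self_eq_zero] at hxx
    exact hx hxx
  have hcons : ∀ X : Fin m → Fin (n + 1) → ℝ,
      (fun i => (O : Matrix (Fin (n + 1)) (Fin (n + 1)) ℝ) *ᵥ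
        (Fin.cons x X : Fin (m + 1) → Fin (n + 1) → ℝ) i) =
      Fin.cons (Pi.single (Fin.last n) r)
        (fun i => (O : Matrix (Fin (n + 1)) (Fin (n + 1)) ℝ) *ᵥ X i) := by
    intro X
    ext i j
    refine Fin.cases ?_ (fun i => ?_) i
    · simp [hOx]
    · simp
  rw [hxx, ← lintegral_gaussWeight_mul_splitCoords (F := fun Y => F (r ^ 2 * (dotGram Y).det))
    (hF.comp ((measurable_det_dotGram m n).const_mul _)),
    ← (measurePreserving_orthogonal O).lintegral_comp
      (f := fun X => gaussWeight X * F (r ^ 2 * (dotGram (splitCoords m n 1 X).1).det))]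
  · congr 1
    ext X
    rw [gaussWeight_orthogonal, ← det_dotGram_cons_single_last hr, ← hcons, dotGram_orthogonal]
  · exact (measurable_gaussWeight m (n + 1)).mul (hF.comp
      (((measurable_det_dotGram m n).comp (measurable_fst.comp
        (splitCoords m n 1).measurable)).const_mul _))

/-- The distribution of the Gram determinant of `m` Gaussian vectors in `ℝⁿ`. -/
theorem exists_lintegral_det_dotGram (m : ℕ) : ∀ n, m ≤ n → ∃ C : ℝ≥0∞, C ≠ 0 ∧ C ≠ ∞ ∧
    ∀ F : ℝ → ℝ≥0∞, Measurable F →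
      ∫⁻ X : Fin m → Fin n → ℝ, gaussWeight X * F (dotGram X).det =
        C * ∫⁻ x, ENNReal.ofReal (x ^ (((n : ℝ) - m - 1) / 2)) * F x ∂siegelDetMeasure m := by
  induction m with
  | zero =>
    intro n _
    refine ⟨1, one_ne_zero, ENNReal.one_ne_top, fun F hF => ?_⟩
    rw [siegelDetMeasure_zero, lintegral_dirac' _ (by fun_prop), volume_pi, Measure.pi_of_empty,
      lintegral_dirac]
    simp [gaussWeight, Matrix.trace]
  | succ m ih =>
    intro n hn
    obtain ⟨n, rfl⟩ : ∃ n', n = n' + 1 := ⟨n - 1, by omega⟩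
    -- The number of vectors and the dimension drop together, so the exponent `(n - m - 1)/2` is the
    -- same at every stage.
    obtain ⟨C, hC0, hCt, hC⟩ := ih n (by omega)
    obtain ⟨c, hc0, hct, hc⟩ := exists_lintegral_dotProduct_self n
    set T := ∫⁻ Z : Fin m → Fin 1 → ℝ, gaussWeight Z with hT
    have hπ : ENNReal.ofReal (Real.pi ^ (-(m / 2 : ℝ))) ≠ 0 := by
      simp only [ne_eq, ENNReal.ofReal_eq_zero, not_le]
      exact Real.rpow_pos_of_pos Real.pi_pos _
    -- The factors stem from the dropped coordinate, the induction hypothesis and polar coordinates;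
    -- the power of `π` cancels the one in `cornerMeasure`.
    refine ⟨T * C * c * ENNReal.ofReal (Real.pi ^ (-(m / 2 : ℝ))),
      mul_ne_zero (mul_ne_zero (mul_ne_zero (lintegral_gaussWeight_ne_zero m 1) hC0) hc0) hπ,
      ENNReal.mul_ne_top (ENNReal.mul_ne_top (ENNReal.mul_ne_top
        (lintegral_gaussWeight_ne_top m 1) hCt) hct) ENNReal.ofReal_ne_top, fun F hF => ?_⟩
    set H : ℝ → ℝ≥0∞ := fun a => ∫⁻ y, ENNReal.ofReal (y ^ (((n : ℝ) - m - 1) / 2)) * F (a * y)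
      ∂siegelDetMeasure m with hH
    have hHm : Measurable H := by
      have : Measurable fun p : ℝ × ℝ =>
          ENNReal.ofReal (p.2 ^ (((n : ℝ) - m - 1) / 2)) * F (p.1 * p.2) := by fun_prop
      exact this.lintegral_prod_right'
    have hΦ : Measurable fun X : Fin (m + 1) → Fin (n + 1) → ℝ =>
        gaussWeight X * F (dotGram X).det :=
      (measurable_gaussWeight _ _).mul (hF.comp (measurable_det_dotGram _ _))
    have hcons := (volume_preserving_piFinSuccAbove
      (fun _ : Fin (m + 1) => Fin (n + 1) → ℝ) 0).symm
    have hcons_apply : ∀ p : (Fin (n + 1) → ℝ) × (Fin m → Fin (n + 1) → ℝ),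
        (MeasurableEquiv.piFinSuccAbove (fun _ : Fin (m + 1) => Fin (n + 1) → ℝ) 0).symm p =
          (Fin.cons p.1 p.2 : Fin (m + 1) → Fin (n + 1) → ℝ) := by
      intro p
      simp only [MeasurableEquiv.piFinSuccAbove, MeasurableEquiv.symm_mk, MeasurableEquiv.coe_mk,
        Fin.insertNthEquiv_zero, Equiv.symm_symm]
      rfl
    have hLHS : ∫⁻ X : Fin (m + 1) → Fin (n + 1) → ℝ, gaussWeight X * F (dotGram X).det =
        ∫⁻ x : Fin (n + 1) → ℝ, T * C * (ENNReal.ofReal (Real.exp (-(x ⬝ᵥ x))) * H (x ⬝ᵥ x)) := by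
      rw [← hcons.lintegral_comp hΦ, Measure.volume_eq_prod, lintegral_prod
        (fun p => gaussWeight ((MeasurableEquiv.piFinSuccAbove
          (fun _ : Fin (m + 1) => Fin (n + 1) → ℝ) 0).symm p) * F (dotGram
          ((MeasurableEquiv.piFinSuccAbove (fun _ : Fin (m + 1) => Fin (n + 1) → ℝ) 0).symm p)).det)
        (hΦ.comp (MeasurableEquiv.measurable _)).aemeasurable]
      refine lintegral_congr_ae ?_
      have hne : ∀ᵐ x : Fin (n + 1) → ℝ, x ≠ 0 := by
        rw [ae_iff]
        simp
      filter_upwards [hne] with x hx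
      simp only [hcons_apply, gaussWeight_cons, mul_assoc]
      rw [lintegral_const_mul, lintegral_det_dotGram_cons hx hF,
        hC (fun y => F ((x ⬝ᵥ x) * y)) (by fun_prop)]
      · rw [← mul_assoc, ← mul_assoc, mul_comm]
        ring
      · exact (measurable_gaussWeight _ _).mul (hF.comp ((measurable_det_dotGram _ _).comp
          (measurable_finCons.comp measurable_prodMk_left)))
    rw [hLHS, lintegral_const_mul, hc (fun a => ENNReal.ofReal (Real.exp (-a)) * H a) (by fun_prop),
      lintegral_siegelDetMeasure_succ m (by fun_prop), lintegral_cornerMeasure]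
    · rw [mul_assoc (T * C) c, mul_assoc (T * C), mul_assoc c]
      congr 2
      rw [← lintegral_const_mul]
      · refine setLIntegral_congr_fun measurableSet_Ioi fun a ha => ?_
        have ha' : (0 : ℝ) < a := ha
        have hin : ∫⁻ x, ENNReal.ofReal ((a * x) ^ ((((n + 1 : ℕ) : ℝ) - (m + 1 : ℕ) - 1) / 2)) *
            F (a * x) ∂siegelDetMeasure m =
            ENNReal.ofReal (a ^ (((n : ℝ) - m - 1) / 2)) * H a := by
          rw [hH, ← lintegral_const_mul _ (by fun_prop)]
          refine lintegral_congr_ae ?_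
          filter_upwards [ae_siegelDetMeasure_pos m] with x hx
          have e : (((n + 1 : ℕ) : ℝ) - (m + 1 : ℕ) - 1) / 2 = ((n : ℝ) - m - 1) / 2 := by
            push_cast; ring
          rw [e, Real.mul_rpow ha'.le hx.le, ENNReal.ofReal_mul (by positivity), mul_assoc]
        rw [hin, ← mul_assoc, ← mul_assoc, ← mul_assoc, ← ENNReal.ofReal_mul (by positivity),
          ← ENNReal.ofReal_mul (by positivity), ← ENNReal.ofReal_mul (by positivity)]
        congr 2
        rw [Real.mul_rpow Real.pi_pos.le ha'.le, Real.rpow_neg Real.pi_pos.le]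
        -- The radial density splits into the power in `cornerMeasure` and the power pulled out of
        -- `(a * x)^((n-m-1)/2)`.
        have e : ((n : ℝ) - 1) / 2 = m / 2 + ((n : ℝ) - m - 1) / 2 := by ring
        rw [e, Real.rpow_add ha']
        have := (Real.rpow_pos_of_pos Real.pi_pos (m / 2 : ℝ)).ne'
        field_simp
      · refine Measurable.mul (by fun_prop) ?_
        exact Measurable.lintegral_prod_right' (f := fun p : ℝ × ℝ => ENNReal.ofReal
          ((p.1 * p.2) ^ ((((n + 1 : ℕ) : ℝ) - (m + 1 : ℕ) - 1) / 2)) * F (p.1 * p.2)) (by fun_prop)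
    · exact Measurable.lintegral_prod_right' (f := fun p : ℝ × ℝ => ENNReal.ofReal
          ((p.1 * p.2) ^ ((((n + 1 : ℕ) : ℝ) - (m + 1 : ℕ) - 1) / 2)) * F (p.1 * p.2)) (by fun_prop)
    · simp only [dotProduct]; fun_prop

/-! ### Haar measure on `O(n)` and blocks of orthogonal matrices. -/

instance (n : ℕ) : SecondCountableTopology (orthogonalGroup (Fin n) ℝ) := by
  have : SecondCountableTopology (Matrix (Fin n) (Fin n) ℝ) :=
    inferInstanceAs (SecondCountableTopology (Fin n → Fin n → ℝ))
  exact Topology.IsEmbedding.subtypeVal.secondCountableTopology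

instance (n m : ℕ) : SecondCountableTopology (Stiefel n m) := by
  have : SecondCountableTopology (Matrix (Fin n) (Fin m) ℝ) :=
    inferInstanceAs (SecondCountableTopology (Fin n → Fin m → ℝ))
  exact TopologicalSpace.secondCountableTopology_induced _ _ _

instance (n : ℕ) : IsProbabilityMeasure (orthogonalHaar n) := ⟨Measure.haarMeasure_self⟩

instance (n : ℕ) : (orthogonalHaar n).IsMulLeftInvariant := by
  rw [orthogonalHaar]
  infer_instance

/-- Uniqueness yields right invariance and inversion invariance, since right translates and the
inverse of the Haar measure are again left invariant probability measures. -/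
theorem eq_orthogonalHaar {n : ℕ} (μ : Measure (orthogonalGroup (Fin n) ℝ))
    [IsProbabilityMeasure μ] [μ.IsMulLeftInvariant] : μ = orthogonalHaar n := by
  have h := Measure.haarMeasure_unique μ ⊤
  rw [TopologicalSpace.PositiveCompacts.coe_top, measure_univ, one_smul] at h
  exact h

instance (n : ℕ) : (orthogonalHaar n).IsMulRightInvariant := by
  constructor
  intro g
  have : IsProbabilityMeasure ((orthogonalHaar n).map (· * g)) :=
    Measure.isProbabilityMeasure_map (measurable_mul_const g).aemeasurable
  exact eq_orthogonalHaar _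

instance (n : ℕ) : (orthogonalHaar n).IsInvInvariant := by
  constructor
  have : IsProbabilityMeasure (orthogonalHaar n).inv :=
    Measure.isProbabilityMeasure_map measurable_inv.aemeasurable
  exact eq_orthogonalHaar _

/-- The Gram matrix of the upper left `m × k` block of an orthogonal matrix. -/
def blockGram {n m k : ℕ} (hm : m ≤ n) (hk : k ≤ n) (g : orthogonalGroup (Fin n) ℝ) :
    Matrix (Fin m) (Fin m) ℝ :=
  (g : Matrix (Fin n) (Fin n) ℝ).submatrix (Fin.castLE hm) (Fin.castLE hk) *
    ((g : Matrix (Fin n) (Fin n) ℝ).submatrix (Fin.castLE hm) (Fin.castLE hk))ᵀ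

theorem continuous_det_blockGram {n m k : ℕ} (hm : m ≤ n) (hk : k ≤ n) :
    Continuous fun g => (blockGram hm hk g).det := by
  have h : Continuous fun g : orthogonalGroup (Fin n) ℝ =>
      (g : Matrix (Fin n) (Fin n) ℝ).submatrix (Fin.castLE hm) (Fin.castLE hk) :=
    continuous_subtype_val.matrix_submatrix _ _
  exact (h.matrix_mul h.matrix_transpose).matrix_det

theorem det_blockGram_nonneg {n m k : ℕ} (hm : m ≤ n) (hk : k ≤ n)
    (g : orthogonalGroup (Fin n) ℝ) : 0 ≤ (blockGram hm hk g).det := by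
  have h := posSemidef_self_mul_conjTranspose
    ((g : Matrix (Fin n) (Fin n) ℝ).submatrix (Fin.castLE hm) (Fin.castLE hk))
  rw [conjTranspose_eq_transpose_of_trivial] at h
  exact h.det_nonneg

/-- A family of `m ≤ n` vectors lies in the span of the first `m` columns of an orthogonal
matrix. -/
theorem exists_eq_mul_orthogonal {n m : ℕ} (hm : m ≤ n) (X : Fin m → Fin n → ℝ) :
    ∃ (Q : orthogonalGroup (Fin n) ℝ) (A : Matrix (Fin m) (Fin m) ℝ),
      Matrix.of X = A * ((Q : Matrix (Fin n) (Fin n) ℝ).submatrix id (Fin.castLE hm))ᵀ := by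
  -- Gram–Schmidt on the family padded by zeros to length `n`. Linear independence is not required,
  -- and triangularity confines the expansion of each given vector to the first `m` basis vectors.
  set f : Fin n → EuclideanSpace ℝ (Fin n) := fun i =>
    if h : (i : ℕ) < m then WithLp.toLp 2 (X ⟨i, h⟩) else 0 with hf
  set b := InnerProductSpace.gramSchmidtOrthonormalBasis (finrank_euclideanSpace (𝕜 := ℝ)) f
    with hb
  set e := EuclideanSpace.basisFun (Fin n) ℝ
  refine ⟨⟨e.toBasis.toMatrix b, e.toMatrix_orthonormalBasis_mem_orthogonal b⟩,
    Matrix.of fun i j => b.repr (f (Fin.castLE hm i)) (Fin.castLE hm j), ?_⟩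
  ext i l
  have h1 : X i l = f (Fin.castLE hm i) l := by
    simp [hf]
  have h2 := congr_arg (fun v : EuclideanSpace ℝ (Fin n) => v l)
    (b.sum_repr (f (Fin.castLE hm i)))
  simp only [WithLp.ofLp_sum, Finset.sum_apply, WithLp.ofLp_smul, Pi.smul_apply,
    smul_eq_mul] at h2
  rw [of_apply, h1, ← h2, mul_apply]
  have h3 : ∀ j : Fin m, (Matrix.of fun i j => b.repr (f (Fin.castLE hm i)) (Fin.castLE hm j)) i j *
      ((e.toBasis.toMatrix b).submatrix id (Fin.castLE hm))ᵀ j l =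
      b.repr (f (Fin.castLE hm i)) (Fin.castLE hm j) * b (Fin.castLE hm j) l := by
    intro j
    simp [Module.Basis.toMatrix_apply, e]
  simp only [h3]
  symm
  rw [← Finset.sum_image (s := Finset.univ) (g := Fin.castLE hm)
    (f := fun j => b.repr (f (Fin.castLE hm i)) j * b j l)
    (fun x _ y _ h => Fin.castLE_injective hm h)]
  refine Finset.sum_subset (Finset.subset_univ _) fun j _ hj => ?_
  have hij : Fin.castLE hm i < j := by
    by_contra! hle
    apply hj
    have : (j : ℕ) < m := lt_of_le_of_lt (show (j : ℕ) ≤ i from hle) i.2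
    exact Finset.mem_image.mpr ⟨⟨j, this⟩, Finset.mem_univ _, rfl⟩
  rw [InnerProductSpace.gramSchmidtOrthonormalBasis_inv_triangular' _ _ hij, zero_mul]

theorem of_mulVec {n m : ℕ} (O : Matrix (Fin n) (Fin n) ℝ) (X : Fin m → Fin n → ℝ) :
    Matrix.of (fun i => O *ᵥ X i) = Matrix.of X * Oᵀ := by
  ext i j
  simp [mul_apply, mulVec, dotProduct, mul_comm]

/-- Write `X = A Q₁'` with `Q₁` the first `m` columns of an orthogonal matrix. Then `XX' = AA'`, and
the first `k` columns of `Xg` are `A` times a block, so determinants multiply. The rotation depends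
on `X` alone, so left invariance of the Haar measure can absorb it. -/
theorem exists_det_dotGram_eq {m k l : ℕ} (hm : m ≤ k + l) (X : Fin m → Fin (k + l) → ℝ) :
    ∃ Q : orthogonalGroup (Fin (k + l)) ℝ, ∀ g : orthogonalGroup (Fin (k + l)) ℝ,
      (dotGram (splitCoords m k l fun i =>
        ((g⁻¹ : orthogonalGroup (Fin (k + l)) ℝ) : Matrix _ _ ℝ) *ᵥ X i).1).det =
        (blockGram hm (Nat.le_add_right k l) (Q * g)).det * (dotGram X).det := by
  obtain ⟨Q, A, hA⟩ := exists_eq_mul_orthogonal hm X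
  refine ⟨Q⁻¹, fun g => ?_⟩
  have hQ : (Q : Matrix (Fin (k + l)) (Fin (k + l)) ℝ)ᵀ * (Q : Matrix _ _ ℝ) = 1 :=
    (mem_orthogonalGroup_iff' _ ℝ).mp Q.2
  have hX : dotGram X = A * Aᵀ := by
    have : (((Q : Matrix (Fin (k + l)) (Fin (k + l)) ℝ)).submatrix id (Fin.castLE hm))ᵀ *
        ((Q : Matrix (Fin (k + l)) (Fin (k + l)) ℝ)).submatrix id (Fin.castLE hm) = 1 := by
      rw [transpose_submatrix, ← submatrix_mul _ _ _ id _ Function.bijective_id, hQ]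
      exact submatrix_one _ (Fin.castLE_injective hm)
    rw [dotGram, hA, transpose_mul, transpose_transpose, Matrix.mul_assoc,
      ← Matrix.mul_assoc _ _ Aᵀ, this, Matrix.one_mul]
  have hsplit : Matrix.of (splitCoords m k l fun i =>
      ((g⁻¹ : orthogonalGroup (Fin (k + l)) ℝ) : Matrix _ _ ℝ) *ᵥ X i).1 =
      A * (((Q⁻¹ * g : orthogonalGroup (Fin (k + l)) ℝ) : Matrix _ _ ℝ)).submatrix (Fin.castLE hm)
        (Fin.castLE (Nat.le_add_right k l)) := by
    have h1 : Matrix.of (splitCoords m k l fun i =>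
        ((g⁻¹ : orthogonalGroup (Fin (k + l)) ℝ) : Matrix _ _ ℝ) *ᵥ X i).1 =
        (Matrix.of X * (g : Matrix (Fin (k + l)) (Fin (k + l)) ℝ)).submatrix id
          (Fin.castLE (Nat.le_add_right k l)) := by
      have h2 := of_mulVec ((g⁻¹ : orthogonalGroup (Fin (k + l)) ℝ) : Matrix _ _ ℝ) X
      have h3 : ((g⁻¹ : orthogonalGroup (Fin (k + l)) ℝ) : Matrix (Fin (k + l)) (Fin (k + l)) ℝ)ᵀ =
        (g : Matrix (Fin (k + l)) (Fin (k + l)) ℝ) := transpose_transpose _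
      rw [h3] at h2
      rw [← h2, splitCoords_apply]
      rfl
    rw [h1, hA, Matrix.mul_assoc]
    rfl
  rw [dotGram, hsplit, hX, transpose_mul, Matrix.mul_assoc, ← Matrix.mul_assoc _ _ Aᵀ]
  change (A * (blockGram hm (Nat.le_add_right k l) (Q⁻¹ * g) * Aᵀ)).det = _
  simp only [det_mul]
  ring

/-- Averaging the rotation invariant Gaussian integral over `O(n)` and exchanging the integrals
makes the block determinant and the full Gram determinant independent. -/
theorem lintegral_splitCoords_eq_lintegral_orthogonalHaar {m k l : ℕ} (hm : m ≤ k + l)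
    {F : ℝ → ℝ≥0∞} (hF : Measurable F) :
    ∫⁻ X : Fin m → Fin (k + l) → ℝ, gaussWeight X * F (dotGram (splitCoords m k l X).1).det =
      ∫⁻ g, (∫⁻ X : Fin m → Fin (k + l) → ℝ, gaussWeight X *
        F ((blockGram hm (Nat.le_add_right k l) g).det * (dotGram X).det))
          ∂orthogonalHaar (k + l) := by
  set Φ : (Fin m → Fin (k + l) → ℝ) → ℝ≥0∞ :=
    fun X => gaussWeight X * F (dotGram (splitCoords m k l X).1).det with hΦ
  have hΦm : Measurable Φ := (measurable_gaussWeight _ _).mul (hF.comp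
    ((measurable_det_dotGram _ _).comp (measurable_fst.comp (splitCoords m k l).measurable)))
  set act : orthogonalGroup (Fin (k + l)) ℝ → (Fin m → Fin (k + l) → ℝ) → Fin m → Fin (k + l) → ℝ :=
    fun g X i => ((g⁻¹ : orthogonalGroup (Fin (k + l)) ℝ) :
      Matrix (Fin (k + l)) (Fin (k + l)) ℝ) *ᵥ X i with hact_def
  have hact : Measurable fun p : orthogonalGroup (Fin (k + l)) ℝ × (Fin m → Fin (k + l) → ℝ) =>
      act p.1 p.2 := by
    refine Continuous.measurable (continuous_pi fun i => ?_)
    exact Continuous.matrix_mulVec (continuous_subtype_val.comp continuous_fst.inv)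
      ((continuous_apply i).comp continuous_snd)
  set Θ : orthogonalGroup (Fin (k + l)) ℝ → (Fin m → Fin (k + l) → ℝ) → ℝ≥0∞ := fun g X =>
    gaussWeight X * F ((blockGram hm (Nat.le_add_right k l) g).det * (dotGram X).det) with hΘ
  have hΘm : Measurable (Function.uncurry Θ) := by
    refine ((measurable_gaussWeight _ _).comp measurable_snd).mul (hF.comp ?_)
    exact ((continuous_det_blockGram hm _).measurable.comp measurable_fst).mul
      ((measurable_det_dotGram _ _).comp measurable_snd)
  have hΦΘ : ∀ X, ∫⁻ g, Φ (act g X) ∂orthogonalHaar (k + l) =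
      ∫⁻ g, Θ g X ∂orthogonalHaar (k + l) := by
    intro X
    obtain ⟨Q, hQ⟩ := exists_det_dotGram_eq hm X
    have h : ∀ g, Φ (act g X) = Θ (Q * g) X := by
      intro g
      simp only [hΦ, hact_def, hΘ]
      rw [gaussWeight_orthogonal, hQ]
    simp only [h]
    exact lintegral_mul_left_eq_self (μ := orthogonalHaar (k + l)) (fun g => Θ g X) Q
  have hinv : ∀ g, ∫⁻ X, Φ (act g X) = ∫⁻ X, Φ X :=
    fun g => (measurePreserving_orthogonal g⁻¹).lintegral_comp hΦm
  calc ∫⁻ X, Φ X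
      = ∫⁻ g, (∫⁻ X, Φ (act g X)) ∂orthogonalHaar (k + l) := by simp [hinv]
    _ = ∫⁻ X, (∫⁻ g, Φ (act g X) ∂orthogonalHaar (k + l)) :=
        lintegral_lintegral_swap (hΦm.comp hact).aemeasurable
    _ = ∫⁻ X, (∫⁻ g, Θ g X ∂orthogonalHaar (k + l)) := by simp only [hΦΘ]
    _ = ∫⁻ g, (∫⁻ X, Θ g X) ∂orthogonalHaar (k + l) :=
        (lintegral_lintegral_swap hΘm.aemeasurable).symm

/-! ### Moments of the block determinant. -/

/-- The distribution of the block determinant under the Haar measure, as a ratio of two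
distributions of Gram determinants. -/
theorem exists_lintegral_blockGram {n m k : ℕ} (hm : m ≤ n) (hk : k ≤ n) (hmk : m ≤ k) :
    ∃ C : ℝ≥0∞, C ≠ 0 ∧ C ≠ ∞ ∧ ∀ F : ℝ → ℝ≥0∞, Measurable F →
      ∫⁻ x, ENNReal.ofReal (x ^ (((k : ℝ) - m - 1) / 2)) * F x ∂siegelDetMeasure m =
        C * ∫⁻ g, ∫⁻ x, ENNReal.ofReal (x ^ (((n : ℝ) - m - 1) / 2)) *
          F ((blockGram hm hk g).det * x) ∂siegelDetMeasure m ∂orthogonalHaar n := by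
  obtain ⟨l, rfl⟩ := Nat.exists_eq_add_of_le hk
  obtain ⟨C, hC0, hCt, hC⟩ := exists_lintegral_det_dotGram m k hmk
  obtain ⟨C', hC0', hCt', hC'⟩ := exists_lintegral_det_dotGram m (k + l) hm
  set T := ∫⁻ Z : Fin m → Fin l → ℝ, gaussWeight Z with hT
  have hT0 : T ≠ 0 := lintegral_gaussWeight_ne_zero m l
  have hTt : T ≠ ∞ := lintegral_gaussWeight_ne_top m l
  have hTC0 : T * C ≠ 0 := mul_ne_zero hT0 hC0
  have hTCt : T * C ≠ ∞ := ENNReal.mul_ne_top hTt hCt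
  refine ⟨(T * C)⁻¹ * C', mul_ne_zero (ENNReal.inv_ne_zero.mpr hTCt) hC0',
    ENNReal.mul_ne_top (ENNReal.inv_ne_top.mpr hTC0) hCt', fun F hF => ?_⟩
  have h := lintegral_splitCoords_eq_lintegral_orthogonalHaar hm hF
  rw [lintegral_gaussWeight_mul_splitCoords (F := fun Y => F (dotGram Y).det)
    (hF.comp (measurable_det_dotGram m k)), hC F hF, ← mul_assoc] at h
  have h2 : ∀ g, ∫⁻ X : Fin m → Fin (k + l) → ℝ, gaussWeight X *
      F ((blockGram hm (Nat.le_add_right k l) g).det * (dotGram X).det) =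
      C' * ∫⁻ x, ENNReal.ofReal (x ^ ((((k + l : ℕ) : ℝ) - m - 1) / 2)) *
        F ((blockGram hm hk g).det * x) ∂siegelDetMeasure m :=
    fun g => hC' (fun x => F ((blockGram hm hk g).det * x)) (by fun_prop)
  simp only [h2] at h
  rw [lintegral_const_mul' _ _ hCt'] at h
  rw [mul_assoc, ← h, ← mul_assoc, ENNReal.inv_mul_cancel hTC0 hTCt, one_mul]

/-- Powers are multiplicative, so the double integral factors. The identity is not written as a
quotient because the integrals may be infinite. -/
theorem exists_lintegral_rpow_blockGram {n m k : ℕ} (hm : m ≤ n) (hk : k ≤ n) (hmk : m ≤ k) :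
    ∃ C : ℝ≥0∞, C ≠ 0 ∧ C ≠ ∞ ∧ ∀ t : ℝ,
      ∫⁻ x, ENNReal.ofReal (x ^ (((k : ℝ) - m - 1) / 2 + t)) ∂siegelDetMeasure m =
        C * ((∫⁻ g, ENNReal.ofReal ((blockGram hm hk g).det ^ t) ∂orthogonalHaar n) *
          ∫⁻ x, ENNReal.ofReal (x ^ (((n : ℝ) - m - 1) / 2 + t)) ∂siegelDetMeasure m) := by
  obtain ⟨C, hC0, hCt, hC⟩ := exists_lintegral_blockGram hm hk hmk
  have hadd : ∀ p t : ℝ, ∫⁻ x, ENNReal.ofReal (x ^ (p + t)) ∂siegelDetMeasure m =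
      ∫⁻ x, ENNReal.ofReal (x ^ p) * ENNReal.ofReal (x ^ t) ∂siegelDetMeasure m := by
    intro p t
    refine lintegral_congr_ae ?_
    filter_upwards [ae_siegelDetMeasure_pos m] with x hx
    rw [Real.rpow_add hx, ENNReal.ofReal_mul (by positivity)]
  refine ⟨C, hC0, hCt, fun t => ?_⟩
  rw [hadd, hadd, hC (fun x => ENNReal.ofReal (x ^ t)) (by fun_prop), ← lintegral_mul_const]
  · congr 2
    ext g
    rw [← lintegral_const_mul _ (by fun_prop)]
    refine lintegral_congr_ae ?_
    filter_upwards [ae_siegelDetMeasure_pos m] with x hx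
    rw [Real.mul_rpow (det_blockGram_nonneg hm hk g) hx.le,
      ENNReal.ofReal_mul (Real.rpow_nonneg (det_blockGram_nonneg hm hk g) _)]
    ring
  · exact ((continuous_det_blockGram hm hk).measurable.pow_const t).ennreal_ofReal

/-- Real moments of the block determinant are finite above the critical exponent. -/
theorem lintegral_rpow_det_blockGram_lt_top {n m k : ℕ} (hm : m ≤ n) (hk : k ≤ n) (hmk : m ≤ k)
    {t : ℝ} (ht : (m : ℝ) - 1 < 2 * t + k) :
    ∫⁻ g, ENNReal.ofReal ((blockGram hm hk g).det ^ t) ∂orthogonalHaar n < ∞ := by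
  obtain ⟨C, hC0, hCt, hC⟩ := exists_lintegral_rpow_blockGram hm hk hmk
  have h := hC t
  have hfin := lintegral_rpow_siegelDetMeasure_lt_top m (t := ((k : ℝ) - m - 1) / 2 + t)
    (by linarith)
  rw [h] at hfin
  by_contra htop
  rw [not_lt, top_le_iff] at htop
  rw [htop, ENNReal.top_mul (lintegral_rpow_siegelDetMeasure_ne_zero m _),
    ENNReal.mul_top hC0] at hfin
  exact lt_irrefl _ hfin

/-- Real moments of the block determinant are infinite up to the critical exponent. -/
theorem lintegral_rpow_det_blockGram_eq_top {n m k : ℕ} (hm0 : 1 ≤ m) (hm : m ≤ n) (hk : k < n)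
    (hmk : m ≤ k) {t : ℝ} (ht : 2 * t + k ≤ (m : ℝ) - 1) :
    ∫⁻ g, ENNReal.ofReal ((blockGram hm hk.le g).det ^ t) ∂orthogonalHaar n = ∞ := by
  have hmk' : (m : ℝ) ≤ k := by exact_mod_cast hmk
  have hkn' : (k : ℝ) < n := by exact_mod_cast hk
  -- The critical exponent: the left side of the moment identity becomes the divergent moment of
  -- order `-1`, while on the right the order is `(n-k)/2 - 1 > -1`, as `k < n`. The block moment
  -- must therefore be infinite.
  set t₀ : ℝ := ((m : ℝ) - 1 - k) / 2 with ht₀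
  have hcrit : ∫⁻ g, ENNReal.ofReal ((blockGram hm hk.le g).det ^ t₀) ∂orthogonalHaar n = ∞ := by
    obtain ⟨C, hC0, hCt, hC⟩ := exists_lintegral_rpow_blockGram hm hk.le hmk
    have h := hC t₀
    have e : ((k : ℝ) - m - 1) / 2 + t₀ = -1 := by rw [ht₀]; ring
    obtain ⟨m, rfl⟩ : ∃ m', m = m' + 1 := ⟨m - 1, by omega⟩
    rw [e, lintegral_inv_siegelDetMeasure] at h
    by_contra hne
    refine absurd h.symm (ENNReal.mul_ne_top hCt (ENNReal.mul_ne_top hne ?_))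
    refine (lintegral_rpow_siegelDetMeasure_lt_top (m + 1) ?_).ne
    rw [ht₀]
    linarith
  -- Lower exponents follow by comparison, `x^t₀ ≤ x^t + 1`. At `x = 0` the negative power `x^t₀` is
  -- `0` by convention.
  have hle : ∀ g, ENNReal.ofReal ((blockGram hm hk.le g).det ^ t₀) ≤
      ENNReal.ofReal ((blockGram hm hk.le g).det ^ t) + 1 := by
    intro g
    rw [← ENNReal.ofReal_one, ← ENNReal.ofReal_add
      (Real.rpow_nonneg (det_blockGram_nonneg hm hk.le g) _) zero_le_one]
    refine ENNReal.ofReal_le_ofReal ?_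
    have ht₀neg : t₀ < 0 := by rw [ht₀]; linarith
    have htt₀ : t ≤ t₀ := by rw [ht₀]; linarith
    rcases (det_blockGram_nonneg hm hk.le g).eq_or_lt with h0 | h0
    · rw [← h0, Real.zero_rpow ht₀neg.ne]
      have := Real.rpow_nonneg le_rfl t
      linarith
    rcases le_total (blockGram hm hk.le g).det 1 with h1 | h1
    · have := Real.rpow_le_rpow_of_exponent_ge h0 h1 htt₀
      linarith
    · have := Real.rpow_le_one_of_one_le_of_nonpos h1 ht₀neg.le
      have := Real.rpow_nonneg h0.le t
      linarith
  have := lintegral_mono (μ := orthogonalHaar n) hle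
  rw [hcrit, top_le_iff, lintegral_add_right _ measurable_const] at this
  simpa using this

/-- Recasting the identity for nonnegative functions as an equality of measures makes it available
for complex powers, with one constant for all `s` and no convergence hypothesis. -/
theorem exists_integral_cpow_blockGram {n m k : ℕ} (hm : m ≤ n) (hk : k ≤ n) (hmk : m ≤ k) :
    ∃ c : ℂ, ∀ s : ℂ, siegelGamma m (k / 2 + s) =
      c * ((∫ g, ((blockGram hm hk g).det : ℂ) ^ s ∂orthogonalHaar n) *
        siegelGamma m (n / 2 + s)) := by
  obtain ⟨C, hC0, hCt, hC⟩ := exists_lintegral_blockGram hm hk hmk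
  set ν : ℕ → Measure ℝ := fun j =>
    (siegelDetMeasure m).withDensity fun x => ENNReal.ofReal (x ^ (((j : ℝ) - m - 1) / 2)) with hν
  have hνm : ∀ j : ℕ, Measurable fun x : ℝ => ENNReal.ofReal (x ^ (((j : ℝ) - m - 1) / 2)) :=
    fun j => by fun_prop
  have hmul : Measurable fun p : orthogonalGroup (Fin n) ℝ × ℝ =>
      (blockGram hm hk p.1).det * p.2 :=
    ((continuous_det_blockGram hm hk).measurable.comp measurable_fst).mul measurable_snd
  have hmeas : ν k = C • ((orthogonalHaar n).prod (ν n)).map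
      fun p => (blockGram hm hk p.1).det * p.2 := by
    refine Measure.ext_of_lintegral _ fun F hF => ?_
    rw [lintegral_smul_measure, lintegral_map hF hmul,
      lintegral_prod (fun p => F ((blockGram hm hk p.1).det * p.2)) (hF.comp hmul).aemeasurable,
      hν, lintegral_withDensity_eq_lintegral_mul _ (hνm k) hF]
    refine (hC F hF).trans ?_
    rw [smul_eq_mul]
    congr 2
    ext g
    rw [lintegral_withDensity_eq_lintegral_mul _ (hνm n)
      (g := fun x => F ((blockGram hm hk g).det * x)) (by fun_prop)]
    rfl
  have hgamma : ∀ (j : ℕ) (s : ℂ), siegelGamma m (j / 2 + s) = ∫ x, (x : ℂ) ^ s ∂ν j := by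
    intro j s
    rw [siegelGamma_eq_integral, hν, integral_withDensity_eq_integral_toReal_smul (hνm j) (by simp)]
    refine integral_congr_ae ?_
    filter_upwards [ae_siegelDetMeasure_pos m] with x hx
    rw [ENNReal.toReal_ofReal (by positivity), Complex.real_smul, Complex.ofReal_cpow hx.le,
      ← Complex.cpow_add _ _ (Complex.ofReal_ne_zero.mpr hx.ne')]
    congr 1
    push_cast
    ring
  refine ⟨C.toReal, fun s => ?_⟩
  have hpos : ∀ᵐ x ∂ν n, 0 < x := (withDensity_absolutelyContinuous _ _).ae_le
    (ae_siegelDetMeasure_pos m)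
  rw [hgamma, hgamma, hmeas, integral_smul_measure, integral_map hmul.aemeasurable
    (Complex.measurable_ofReal.pow_const _).aestronglyMeasurable, ← integral_prod_mul,
    Complex.real_smul]
  congr 1
  refine integral_congr_ae ?_
  filter_upwards [Measure.quasiMeasurePreserving_snd.ae hpos] with p hp
  rw [Complex.ofReal_mul, Complex.mul_cpow_ofReal_nonneg (det_blockGram_nonneg hm hk _) hp.le]

/-- Complex moments of the block determinant. -/
theorem integral_cpow_det_blockGram {n m k : ℕ} (hm : m ≤ n) (hk : k ≤ n) (hmk : m ≤ k)
    {α : ℂ} (hα : (m : ℝ) - 1 < α.re) :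
    ∫ g, ((blockGram hm hk g).det : ℂ) ^ ((α - k) / 2) ∂orthogonalHaar n = cosConst n m k α := by
  obtain ⟨c, hc⟩ := exists_integral_cpow_blockGram hm hk hmk
  -- At `s = 0` the integral over the group is `1`, so `c = Γ_m(k/2) / Γ_m(n/2)`.
  have h0 := hc 0
  have h1 := hc ((α - k) / 2)
  have hmk' : (m : ℝ) ≤ k := by exact_mod_cast hmk
  have hkn' : (k : ℝ) ≤ n := by exact_mod_cast hk
  have e1 : (k : ℂ) / 2 + (α - k) / 2 = α / 2 := by ring
  have e2 : (n : ℂ) / 2 + (α - k) / 2 = (α + n - k) / 2 := by ring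
  rw [e1, e2] at h1
  simp only [add_zero, Complex.cpow_zero, integral_const, probReal_univ, one_smul, one_mul] at h0
  have hre : ∀ z : ℂ, (z / 2).re = z.re / 2 := fun z => by simp
  have hk0 : siegelGamma m ((k : ℂ) / 2) ≠ 0 := siegelGamma_ne_zero m (by
    rw [hre, Complex.natCast_re]; linarith)
  have hn0 : siegelGamma m ((α + n - k) / 2) ≠ 0 := siegelGamma_ne_zero m (by
    rw [hre, Complex.sub_re, Complex.add_re, Complex.natCast_re, Complex.natCast_re]; linarith)
  have hc0 : c ≠ 0 := by
    rintro rfl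
    exact hk0 (by simpa using h0)
  rw [cosConst, eq_div_iff (mul_ne_zero hk0 hn0), h0, h1]
  ring

/-- Only an inequality: at `x = 0` with a nonzero imaginary exponent the left side is `0` and the
right side is `0^0 = 1`. -/
theorem norm_cpow_le_rpow_re {x : ℝ} (hx : 0 ≤ x) (c : ℂ) : ‖(x : ℂ) ^ c‖ ≤ x ^ c.re := by
  by_cases hc : c.re = 0
  · rw [hc, Real.rpow_zero]
    rcases hx.eq_or_lt with rfl | hx
    · by_cases hc' : c = 0 <;> simp [hc']
    · rw [Complex.norm_cpow_eq_rpow_re_of_pos hx, hc, Real.rpow_zero]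
  · exact (Complex.norm_cpow_eq_rpow_re_of_nonneg hx hc).le

theorem integrable_cpow_det_blockGram {n m k : ℕ} (hm : m ≤ n) (hk : k ≤ n) (hmk : m ≤ k)
    {α : ℂ} (hα : (m : ℝ) - 1 < α.re) :
    Integrable (fun g => ((blockGram hm hk g).det : ℂ) ^ ((α - k) / 2)) (orthogonalHaar n) := by
  have hre : ((α - k) / 2).re = (α.re - k) / 2 := by simp
  refine ⟨((Complex.measurable_ofReal.comp
    (continuous_det_blockGram hm hk).measurable).pow_const _).aestronglyMeasurable, ?_⟩
  refine lt_of_le_of_lt (lintegral_mono fun g => ?_)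
    (lintegral_rpow_det_blockGram_lt_top hm hk hmk (t := ((α - k) / 2).re) (by rw [hre]; linarith))
  rw [← ofReal_norm]
  exact ENNReal.ofReal_le_ofReal (norm_cpow_le_rpow_re (det_blockGram_nonneg hm hk g) _)

theorem lintegral_enorm_cpow_det_blockGram {n m k : ℕ} (hm0 : 1 ≤ m) (hm : m ≤ n) (hk : k < n)
    (hmk : m ≤ k) {α : ℂ} (hα : α.re ≤ (m : ℝ) - 1) :
    ∫⁻ g, ‖((blockGram hm hk.le g).det : ℂ) ^ ((α - k) / 2)‖ₑ ∂orthogonalHaar n = ∞ := by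
  have hmk' : (m : ℝ) ≤ k := by exact_mod_cast hmk
  have hre : ((α - k) / 2).re = (α.re - k) / 2 := by simp
  rw [← lintegral_rpow_det_blockGram_eq_top hm0 hm hk hmk (t := ((α - k) / 2).re)
    (by rw [hre]; linarith)]
  congr 1
  ext g
  rw [← ofReal_norm, Complex.norm_cpow_eq_rpow_re_of_nonneg
    (det_blockGram_nonneg hm hk.le g)]
  rw [hre]
  -- Since `Re α ≤ m - 1 < k`, the exponent has nonzero real part, and the norm formula is exact
  -- even at zero determinants.
  have : (α.re - k) / 2 < 0 := by linarith
  exact this.ne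

/-! ### The kernels as functions on `O(n)`, and the transforms. -/

theorem continuous_mat {n m : ℕ} : Continuous (Stiefel.mat : Stiefel n m → _) :=
  continuous_induced_dom

theorem measurable_cosKernel {n m k : ℕ} (α : ℂ) :
    Measurable fun p : Stiefel n m × Stiefel n k => cosKernel α p.1 p.2 := by
  have hv : Continuous fun p : Stiefel n m × Stiefel n k => p.1.mat :=
    continuous_mat.comp continuous_fst
  have hu : Continuous fun p : Stiefel n m × Stiefel n k => p.2.mat :=
    continuous_mat.comp continuous_snd
  have h : Continuous fun p : Stiefel n m × Stiefel n k =>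
      |(p.1.matᵀ * p.2.mat * p.2.matᵀ * p.1.mat).det| :=
    ((((hv.matrix_transpose.matrix_mul hu).matrix_mul hu.matrix_transpose).matrix_mul
      hv).matrix_det).abs
  exact (Complex.measurable_ofReal.comp h.measurable).pow_const _

theorem measurable_sinKernel {n m k : ℕ} (α : ℂ) :
    Measurable fun p : Stiefel n m × Stiefel n k => sinKernel α p.1 p.2 := by
  have hv : Continuous fun p : Stiefel n m × Stiefel n k => p.1.mat :=
    continuous_mat.comp continuous_fst
  have hu : Continuous fun p : Stiefel n m × Stiefel n k => p.2.mat :=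
    continuous_mat.comp continuous_snd
  have h : Continuous fun p : Stiefel n m × Stiefel n k =>
      |(1 - p.1.matᵀ * p.2.mat * p.2.matᵀ * p.1.mat).det| :=
    ((continuous_const.sub (((hv.matrix_transpose.matrix_mul hu).matrix_mul
      hu.matrix_transpose).matrix_mul hv)).matrix_det).abs
  exact (Complex.measurable_ofReal.comp h.measurable).pow_const _

theorem transpose_rotate_mul_rotate {n m k : ℕ} (hm : m ≤ n) (hk : k ≤ n)
    (g h : orthogonalGroup (Fin n) ℝ) :
    (rotate g (baseFrame hm)).matᵀ * (rotate h (baseFrame hk)).mat =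
      ((g⁻¹ * h : orthogonalGroup (Fin n) ℝ) : Matrix (Fin n) (Fin n) ℝ).submatrix
        (Fin.castLE hm) (Fin.castLE hk) := by
  have hbase : ∀ {j : ℕ} (hj : j ≤ n) (g : orthogonalGroup (Fin n) ℝ),
      (rotate g (baseFrame hj)).mat =
        (g : Matrix (Fin n) (Fin n) ℝ).submatrix id (Fin.castLE hj) := by
    intro j hj g
    ext a b
    simp [rotate, baseFrame, Stiefel.mat, mul_apply, one_apply]
  rw [hbase, hbase, transpose_submatrix, ← submatrix_mul _ _ _ id _ Function.bijective_id]
  rfl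

theorem transpose_mul_mul_transpose_mul {n m k : ℕ} (hm : m ≤ n) (hk : k ≤ n)
    (g h : orthogonalGroup (Fin n) ℝ) :
    (rotate g (baseFrame hm)).matᵀ * (rotate h (baseFrame hk)).mat *
        (rotate h (baseFrame hk)).matᵀ * (rotate g (baseFrame hm)).mat =
      blockGram hm hk (g⁻¹ * h) := by
  rw [blockGram, ← transpose_rotate_mul_rotate hm hk g h, transpose_mul, transpose_transpose,
    Matrix.mul_assoc]

theorem cosKernel_rotate {n m k : ℕ} (hm : m ≤ n) (hk : k ≤ n) (α : ℂ)
    (g h : orthogonalGroup (Fin n) ℝ) :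
    cosKernel α (rotate g (baseFrame hm)) (rotate h (baseFrame hk)) =
      ((blockGram hm hk (g⁻¹ * h)).det : ℂ) ^ ((α - k) / 2) := by
  rw [cosKernel, transpose_mul_mul_transpose_mul, abs_of_nonneg (det_blockGram_nonneg hm hk _)]

/-- The orthogonal matrix reversing the order of the coordinates. -/
def reversal (n : ℕ) : orthogonalGroup (Fin n) ℝ :=
  ⟨(1 : Matrix (Fin n) (Fin n) ℝ).submatrix id Fin.rev, by
    rw [mem_orthogonalGroup_iff']
    change ((1 : Matrix (Fin n) (Fin n) ℝ).submatrix id Fin.rev)ᵀ *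
      (1 : Matrix (Fin n) (Fin n) ℝ).submatrix id Fin.rev = 1
    rw [transpose_submatrix, ← submatrix_mul _ _ _ id _ Function.bijective_id, transpose_one,
      one_mul]
    exact submatrix_one _ Fin.rev_injective⟩

theorem mul_reversal_apply {n : ℕ} (g : orthogonalGroup (Fin n) ℝ) (i j : Fin n) :
    ((g * reversal n : orthogonalGroup (Fin n) ℝ) : Matrix (Fin n) (Fin n) ℝ) i j =
      (g : Matrix (Fin n) (Fin n) ℝ) i j.rev := by
  change ((g : Matrix (Fin n) (Fin n) ℝ) * (1 : Matrix (Fin n) (Fin n) ℝ).submatrix id Fin.rev) i j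
    = _
  simp [mul_apply, one_apply]

/-- Complementary blocks of the rows of an orthogonal matrix. -/
theorem one_sub_blockGram {n m k : ℕ} (hm : m ≤ n) (hk : k ≤ n) (g : orthogonalGroup (Fin n) ℝ) :
    1 - blockGram hm hk g = blockGram hm (Nat.sub_le n k) (g * reversal n) := by
  obtain ⟨l, rfl⟩ := Nat.exists_eq_add_of_le hk
  have hg : (g : Matrix (Fin (k + l)) (Fin (k + l)) ℝ) * (g : Matrix _ _ ℝ)ᵀ = 1 :=
    (mem_orthogonalGroup_iff _ ℝ).mp g.2
  have hl : k + l - k = l := Nat.add_sub_cancel_left k l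
  ext i j
  -- Orthonormality of the rows, split into the first `k` and the last `n - k` columns. Reversal
  -- moves the latter to the front, and their order does not affect the Gram matrix.
  have h := congr_fun (congr_fun hg (Fin.castLE hm i)) (Fin.castLE hm j)
  have h1 : (1 : Matrix (Fin (k + l)) (Fin (k + l)) ℝ) (Fin.castLE hm i) (Fin.castLE hm j) =
      (1 : Matrix (Fin m) (Fin m) ℝ) i j := by
    simp [one_apply, Fin.castLE_inj]
  rw [h1, mul_apply, Fin.sum_univ_add] at h
  rw [Matrix.sub_apply, ← h, blockGram, blockGram, mul_apply, mul_apply]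
  have h2 : ∀ x : Fin k, Fin.castLE hk x = Fin.castAdd l x := fun x => rfl
  simp only [transpose_apply, submatrix_apply, mul_reversal_apply, h2, add_sub_cancel_left]
  refine Fintype.sum_equiv (Fin.revPerm.trans (finCongr hl.symm)) _ _ fun x => ?_
  have h3 : (Fin.castLE (Nat.sub_le (k + l) k)
      ((Fin.revPerm.trans (finCongr hl.symm)) x)).rev = Fin.natAdd k x := by
    ext
    simp [Fin.val_rev]
    omega
  rw [h3]

/-- The sine exponent is `(α - (n - k))/2`, so this is the cosine kernel of the complementary block,
translated on the right by `reversal n`. -/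
theorem sinKernel_rotate {n m k : ℕ} (hm : m ≤ n) (hk : k ≤ n) (α : ℂ)
    (g h : orthogonalGroup (Fin n) ℝ) :
    sinKernel α (rotate g (baseFrame hm)) (rotate h (baseFrame hk)) =
      ((blockGram hm (Nat.sub_le n k) (g⁻¹ * h * reversal n)).det : ℂ) ^
        ((α - (n - k : ℕ)) / 2) := by
  rw [sinKernel, transpose_mul_mul_transpose_mul, one_sub_blockGram,
    abs_of_nonneg (det_blockGram_nonneg hm _ _)]
  congr 2
  push_cast [hk]
  ring

theorem sinConst_eq_cosConst {n k : ℕ} (hk : k ≤ n) (m : ℕ) (α : ℂ) :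
    sinConst n m k α = cosConst n m (n - k) α := by
  rw [sinConst, cosConst]
  push_cast [hk]
  congr 3
  ring

/-- Convergence and mean value of a transform and of its dual, for an invariant kernel. -/
theorem transform_of_invariantKernel {n m k : ℕ} (hm : m ≤ n) (hk : k ≤ n)
    {K : Stiefel n m → Stiefel n k → ℂ} (hK : Measurable (Function.uncurry K))
    {q : orthogonalGroup (Fin n) ℝ → ℂ} (hqm : Measurable q)
    (hq : ∀ g h, K (rotate g (baseFrame hm)) (rotate h (baseFrame hk)) = q (g⁻¹ * h))
    {P : Prop} {c : ℂ}
    (hP : P → Integrable q (orthogonalHaar n) ∧ ∫ g, q g ∂orthogonalHaar n = c)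
    (hP' : ¬ P → ∫⁻ g, ‖q g‖ₑ ∂orthogonalHaar n = ∞) :
    (∀ f : Stiefel n m → ℂ, Integrable f (stiefelMeasure hm) →
      (¬ f =ᵐ[stiefelMeasure hm] 0 →
        ((∀ᵐ u ∂stiefelMeasure hk, Integrable (fun v => f v * K v u) (stiefelMeasure hm)) ↔ P)) ∧
      (P → Integrable (fun u => ∫ v, f v * K v u ∂stiefelMeasure hm) (stiefelMeasure hk) ∧
        ∫ u, (∫ v, f v * K v u ∂stiefelMeasure hm) ∂stiefelMeasure hk =
          c * ∫ v, f v ∂stiefelMeasure hm)) := by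
  intro f hf
  have ha := measurable_rotate (baseFrame hm)
  have hb := measurable_rotate (baseFrame hk)
  have hpos : P → _ := fun h => integrable_mul_invariantKernel (μ := orthogonalHaar n) ha hb hK hq
    (hP h).1 hf
  refine ⟨fun hf0 => ⟨fun hae => ?_, fun h => ?_⟩, fun h => ⟨?_, ?_⟩⟩
  · by_contra h
    exact not_ae_integrable_mul_invariantKernel (μ := orthogonalHaar n) ha hb hK hqm hq (hP' h) hf
      hf0 hae
  · exact (hpos h).1.prod_left_ae
  · exact (hpos h).1.integral_prod_right
  · have h1 := (hpos h).2
    rw [(hP h).2] at h1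
    exact (integral_prod_symm _ (hpos h).1).symm.trans h1

/-- Exchanging the two spaces replaces `q(g)` by `q(g⁻¹)`, and the Haar measure is invariant under
inversion. -/
theorem dualTransform_of_invariantKernel {n m k : ℕ} (hm : m ≤ n) (hk : k ≤ n)
    {K : Stiefel n m → Stiefel n k → ℂ} (hK : Measurable (Function.uncurry K))
    {q : orthogonalGroup (Fin n) ℝ → ℂ} (hqm : Measurable q)
    (hq : ∀ g h, K (rotate g (baseFrame hm)) (rotate h (baseFrame hk)) = q (g⁻¹ * h))
    {P : Prop} {c : ℂ}
    (hP : P → Integrable q (orthogonalHaar n) ∧ ∫ g, q g ∂orthogonalHaar n = c)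
    (hP' : ¬ P → ∫⁻ g, ‖q g‖ₑ ∂orthogonalHaar n = ∞) :
    (∀ φ : Stiefel n k → ℂ, Integrable φ (stiefelMeasure hk) →
      (¬ φ =ᵐ[stiefelMeasure hk] 0 →
        ((∀ᵐ v ∂stiefelMeasure hm, Integrable (fun u => φ u * K v u) (stiefelMeasure hk)) ↔ P)) ∧
      (P → Integrable (fun v => ∫ u, φ u * K v u ∂stiefelMeasure hk) (stiefelMeasure hm) ∧
        ∫ v, (∫ u, φ u * K v u ∂stiefelMeasure hk) ∂stiefelMeasure hm =
          c * ∫ u, φ u ∂stiefelMeasure hk)) :=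
  transform_of_invariantKernel hk hm (K := fun u v => K v u) (q := fun g => q g⁻¹)
    (hK.comp measurable_swap) (hqm.comp measurable_inv) (fun g h => by simp [hq])
    (fun h => ⟨(hP h).1.comp_inv, (integral_inv_eq_self q _).trans (hP h).2⟩)
    (fun h => (lintegral_inv_eq_self (fun g => ‖q g‖ₑ)).trans (hP' h))

end StiefelTransform

end

theorem mainTheorem12 (n m k : ℕ) (hm : 1 ≤ m) (hmn : m < n) (hk : 1 ≤ k) (hkn : k < n)
    (α : ℂ) :
    -- the cosine transform and its dual
    (m ≤ k →
      (∀ f : Stiefel n m → ℂ,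
        Integrable f (stiefelMeasure hmn.le) →
        (¬ f =ᵐ[stiefelMeasure hmn.le] 0 →
          ((∀ᵐ u ∂stiefelMeasure hkn.le,
              Integrable (fun v => f v * cosKernel α v u)
                (stiefelMeasure hmn.le)) ↔
            (m : ℝ) - 1 < α.re)) ∧
        ((m : ℝ) - 1 < α.re →
          Integrable (cosTransform hmn.le k α f)
            (stiefelMeasure hkn.le) ∧
          ∫ u, cosTransform hmn.le k α f u
              ∂stiefelMeasure hkn.le =
            cosConst n m k α *
              ∫ v, f v ∂stiefelMeasure hmn.le)) ∧
      (∀ φ : Stiefel n k → ℂ,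
        Integrable φ (stiefelMeasure hkn.le) →
        (¬ φ =ᵐ[stiefelMeasure hkn.le] 0 →
          ((∀ᵐ v ∂stiefelMeasure hmn.le,
              Integrable (fun u => φ u * cosKernel α v u)
                (stiefelMeasure hkn.le)) ↔
            (m : ℝ) - 1 < α.re)) ∧
        ((m : ℝ) - 1 < α.re →
          Integrable (dualCosTransform hkn.le m α φ)
            (stiefelMeasure hmn.le) ∧
          ∫ v, dualCosTransform hkn.le m α φ v
              ∂stiefelMeasure hmn.le =
            cosConst n m k α *
              ∫ u, φ u ∂stiefelMeasure hkn.le))) ∧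
    -- the sine transform and its dual
    (m ≤ n - k →
      (∀ f : Stiefel n m → ℂ,
        Integrable f (stiefelMeasure hmn.le) →
        (¬ f =ᵐ[stiefelMeasure hmn.le] 0 →
          ((∀ᵐ u ∂stiefelMeasure hkn.le,
              Integrable (fun v => f v * sinKernel α v u)
                (stiefelMeasure hmn.le)) ↔
            (m : ℝ) - 1 < α.re)) ∧
        ((m : ℝ) - 1 < α.re →
          Integrable (sinTransform hmn.le k α f)
            (stiefelMeasure hkn.le) ∧
          ∫ u, sinTransform hmn.le k α f u
              ∂stiefelMeasure hkn.le =
            sinConst n m k α *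
              ∫ v, f v ∂stiefelMeasure hmn.le)) ∧
      (∀ φ : Stiefel n k → ℂ,
        Integrable φ (stiefelMeasure hkn.le) →
        (¬ φ =ᵐ[stiefelMeasure hkn.le] 0 →
          ((∀ᵐ v ∂stiefelMeasure hmn.le,
              Integrable (fun u => φ u * sinKernel α v u)
                (stiefelMeasure hkn.le)) ↔
            (m : ℝ) - 1 < α.re)) ∧
        ((m : ℝ) - 1 < α.re →
          Integrable (dualSinTransform hkn.le m α φ)
            (stiefelMeasure hmn.le) ∧
          ∫ v, dualSinTransform hkn.le m α φ v
              ∂stiefelMeasure hmn.le =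
            sinConst n m k α *
              ∫ u, φ u ∂stiefelMeasure hkn.le))) := by
  refine ⟨fun hmk => ?_, fun hmk => ?_⟩
  · have hqm : Measurable fun g => ((blockGram hmn.le hkn.le g).det : ℂ) ^ ((α - k) / 2) :=
      (Complex.measurable_ofReal.comp
        (continuous_det_blockGram hmn.le hkn.le).measurable).pow_const _
    have hP : (m : ℝ) - 1 < α.re → _ ∧ _ := fun h =>
      ⟨integrable_cpow_det_blockGram hmn.le hkn.le hmk h,
        integral_cpow_det_blockGram hmn.le hkn.le hmk h⟩
    have hP' := fun h : ¬ (m : ℝ) - 1 < α.re =>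
      lintegral_enorm_cpow_det_blockGram hm hmn.le hkn hmk (not_lt.mp h)
    exact ⟨transform_of_invariantKernel hmn.le hkn.le (measurable_cosKernel α) hqm
        (cosKernel_rotate hmn.le hkn.le α) hP hP',
      dualTransform_of_invariantKernel hmn.le hkn.le (measurable_cosKernel α) hqm
        (cosKernel_rotate hmn.le hkn.le α) hP hP'⟩
  -- The sine case is the cosine case for `n - k`; `1 ≤ k` supplies the strict inequality needed for
  -- divergence, and right invariance removes the factor `reversal n`.
  · have hlt : n - k < n := Nat.sub_lt (by omega) hk
    set p : orthogonalGroup (Fin n) ℝ → ℂ := fun g =>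
      ((blockGram hmn.le hlt.le g).det : ℂ) ^ ((α - (n - k : ℕ)) / 2) with hp
    have hpm : Measurable p :=
      (Complex.measurable_ofReal.comp
        (continuous_det_blockGram hmn.le hlt.le).measurable).pow_const _
    have hqm : Measurable fun g => p (g * reversal n) := hpm.comp (measurable_mul_const _)
    have hP : (m : ℝ) - 1 < α.re → Integrable (fun g => p (g * reversal n)) (orthogonalHaar n) ∧
        ∫ g, p (g * reversal n) ∂orthogonalHaar n = sinConst n m k α := fun h =>
      ⟨(integrable_cpow_det_blockGram hmn.le hlt.le hmk h).comp_mul_right (reversal n), by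
        rw [integral_mul_right_eq_self p (reversal n), sinConst_eq_cosConst hkn.le]
        exact integral_cpow_det_blockGram hmn.le hlt.le hmk h⟩
    have hP' : ¬ (m : ℝ) - 1 < α.re →
        ∫⁻ g, ‖p (g * reversal n)‖ₑ ∂orthogonalHaar n = ⊤ := fun h =>
      (lintegral_mul_right_eq_self (fun g => ‖p g‖ₑ) (reversal n)).trans
        (lintegral_enorm_cpow_det_blockGram hm hmn.le hlt hmk (not_lt.mp h))
    exact ⟨transform_of_invariantKernel hmn.le hkn.le (measurable_sinKernel α) hqm
        (sinKernel_rotate hmn.le hkn.le α) hP hP',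
      dualTransform_of_invariantKernel hmn.le hkn.le (measurable_sinKernel α) hqm
        (sinKernel_rotate hmn.le hkn.le α) hP hP'⟩
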